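/- Let $W\ge 1$ be an integer. A weighted multigraph $G=(V,E)$ is given by a finite vertex set $V$ and a finite multiset $E$ of undirected edges without self-loops, each edge $e$ having an integer weight $w(e)\in\{1,\dots,W\}$ (parallel edges, also of equal weight, are allowed). For a subgraph $H$ of $G$ (a sub-multiset of the edges, on the same vertices) and $v\in V$, let $\mathrm{wdeg}_H(v)$ be the sum of the weights of the edges of $H$ incident to $v$. Let $b_v\ge 1$ ($v\in V$) be integer capacities such that any two vertices $u,v$ are joined by at most $\min(b_u,b_v)$ edges of $G$. A $b$-matching is a multiset $M$ of edges such that every vertex $v$ is incident to at most $b_v$ edges of $M$; $w(M)$ is the sum of the weights of its edges, and $M_H$ denotes any maximum-weight $b$-matching included in $H$. A subgraph $H$ has bounded weighted edge-degree $\beta$ if $\frac{\mathrm{wdeg}_H(u)}{b_u}+\frac{\mathrm{wdeg}_H(v)}{b_v}\le \beta\, w(e)$ for every edge $e$ of $H$, where $u,v$ are the endpoints of $e$. For such an $H$, an edge $e$ of $G\setminus H$ with endpoints $u,v$ is $(H,\beta,\beta^-)$-underfull if $\frac{\mathrm{wdeg}_H(u)}{b_u}+\frac{\mathrm{wdeg}_H(v)}{b_v}<\beta^-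 w(e)$. **Lemma.** Let $0<\varepsilon<1/2$ and let $W\ge1$ be an integer. Set $\lambda=\frac{\varepsilon}{100W}$. Let $\beta^-$ and $\beta\ge\beta^-+2$ be integers such that $$\frac{\beta+8W}{\log(\beta+8W)}\ge 2W^2\lambda^{-2}\qquad\text{and}\qquad \beta^--6W\ge(1-\lambda)(\beta+8W),$$ where $\log$ is the natural logarithm. Let $G$ be a weighted multigraph with weights in $\{1,\dots,W\}$ and capacities $(b_v)$ as above, let $H$ be a subgraph of $G$ with bounded weighted edge-degree $\beta$, and let $X$ be a set of edges of $G$ that contains all $(H,\beta,\beta^-)$-underfull edges of $G\setminus H$. Then $$\Bigl(2-\frac1{2W}+\varepsilon\Bigr)\,w(M_{H\cup X})\ \ge\ w(M_G).$$ -/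

import Mathlib

/-- A weighted multigraph on the vertex set `V`, without self-loops, whose edges are labelled by the
elements of `E` and carry integer weights in `{1, …, W}`. Distinct labels are distinct edges, even
if they have the same endpoints and the same weight, so this is a multiset of weighted edges. -/
structure WeightedMultigraph (V E : Type*) (W : ℕ) where
  ends : E → Sym2 V
  not_loop : ∀ e, ¬ (ends e).IsDiag
  weight : E → ℕ
  one_le_weight : ∀ e, 1 ≤ weight e
  weight_le : ∀ e, weight e ≤ W

namespace WeightedMultigraph

variable {V E : Type*} {W : ℕ} [DecidableEq V]

/-- `δ_H(v)`: the edges of the (spanning) subgraph with edge set `H` that are incident to `v`. -/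
def incident (G : WeightedMultigraph V E W) (H : Finset E) (v : V) : Finset E :=
  H.filter fun e => v ∈ G.ends e

/-- The total weight `w(S)` of a set of edges. -/
def totalWeight (G : WeightedMultigraph V E W) (S : Finset E) : ℕ :=
  ∑ e ∈ S, G.weight e

/-- The weighted degree of `v` in `H`. -/
def wdeg (G : WeightedMultigraph V E W) (H : Finset E) (v : V) : ℕ :=
  G.totalWeight (G.incident H v)

/-- Between any two vertices `u` and `v` there are at most `min (b u) (b v)` edges. -/
def MultiplicityBounded [Fintype E] (G : WeightedMultigraph V E W) (b : V → ℕ) : Prop :=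
  ∀ u v : V, (Finset.univ.filter fun e => G.ends e = s(u, v)).card ≤ min (b u) (b v)

/-- `M` is a `b`-matching: every vertex `v` has at most `b v` edges of `M` incident to it. -/
def IsBMatching (G : WeightedMultigraph V E W) (b : V → ℕ) (M : Finset E) : Prop :=
  ∀ v : V, (G.incident M v).card ≤ b v

/-- `M` is a maximum weight `b`-matching included in the subgraph `H`. -/
def IsMaxWeightBMatching (G : WeightedMultigraph V E W) (b : V → ℕ) (H M : Finset E) : Prop :=
  (M ⊆ H ∧ G.IsBMatching b M) ∧
    ∀ M' : Finset E, M' ⊆ H → G.IsBMatching b M' → G.totalWeight M' ≤ G.totalWeight M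

/-- For a pair `s(u, v)` of vertices, the number `wdeg_H(u) / b u + wdeg_H(v) / b v`. -/
noncomputable def normalizedDeg (G : WeightedMultigraph V E W) (b : V → ℕ) (H : Finset E) :
    Sym2 V → ℝ :=
  Sym2.lift ⟨fun u v => (G.wdeg H u : ℝ) / (b u : ℝ) + (G.wdeg H v : ℝ) / (b v : ℝ),
    fun _ _ => add_comm _ _⟩

/-- `H` has bounded weighted edge-degree `β`. -/
def HasBoundedWeightedEdgeDegree (G : WeightedMultigraph V E W) (b : V → ℕ) (H : Finset E)
    (β : ℤ) : Prop :=
  ∀ e ∈ H, G.normalizedDeg b H (G.ends e) ≤ (β : ℝ) * (G.weight e : ℝ)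

/-- The edge `e` of `G \ H` is `(H, β, βm)`-underfull. The notion is used only for subgraphs `H` of
bounded weighted edge-degree `β`, and the inequality itself does not involve `β`. -/
def IsUnderfull (G : WeightedMultigraph V E W) (b : V → ℕ) (H : Finset E) (βm : ℤ) (e : E) : Prop :=
  e ∉ H ∧ G.normalizedDeg b H (G.ends e) < (βm : ℝ) * (G.weight e : ℝ)

end WeightedMultigraph

/-! Split every vertex v into b_v copies so that the optimal b-matching M of G becomes a matching
and every copy has H-degree within W of wdeg_H(v)/b_v (`exists_vertex_split`). This reduces the
claim to matchings, with K = H ∪ X and the scale x = β + 8W.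

Choose a random bipartition in which the ends of every edge of M get opposite sides. By Hoeffding's
inequality the crossing part of H has about half the degree at a given vertex, except with
probability at most 2/x². A union bound over the O(Wx) vertices near an edge of M and the first
moment method yield one bipartition that is good except near edges carrying at most ε/10 of w(M).

For the crossing edges of K, Egerváry's theorem gives a matching N and an integral cover y with Σ y
≤ w(N). An edge of M that y fails to cover lies outside K, so it is not underfull and its ends have
nearly the largest H-degree allowed. Let δ be the crossing degree (bad vertices removed) divided by
its bound D ≈ x/2. Then δ_u + δ_v ≤ w(e) on the surviving edges of H, and δ_u + δ_v ≥ (1-η)w(e) on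
uncovered good edges of M. Hence the excesses (δ - y)⁺ at the ends of such an edge nearly add up to
its deficit t = w(e) - y_u - y_v, and t ≥ 1 by integrality.

Put r = 1 - 1/(2W) and price an excess s at s(2r - 1 + s/W). Charging across the edges of H bounds
the total price by r² Σ y (`sum_excess_le_cover`), while an uncovered edge collects about rt
(`pair_excess_ge`). Up to small errors, r w(M) ≤ (r + r²) Σ y, so w(M) ≤ (1 + r) w(N), and 1 + r = 2
- 1/(2W). -/

/-! ### Rademacher sums and the first moment method -/

/-- The sign `±1` attached to a boolean. -/
noncomputable def boolSign (b : Bool) : ℝ := if b then 1 else -1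

theorem abs_boolSign (b : Bool) : |boolSign b| = 1 := by
  cases b <;> simp [boolSign]

/-- The moment generating function of a Rademacher sum, as a finite sum over all signs. -/
theorem sum_exp_rademacher {U : Type*} [Fintype U] [DecidableEq U] (a : U → ℝ) :
    ∑ ω : U → Bool, Real.exp (∑ c, a c * boolSign (ω c)) = ∏ c, (2 * Real.cosh (a c)) := by
  have h := Finset.prod_univ_sum (fun _ : U => (Finset.univ : Finset Bool))
    (fun c β => Real.exp (a c * boolSign β))
  rw [Fintype.piFinset_univ] at h
  simp only [Real.exp_sum]
  rw [← h]
  refine Finset.prod_congr rfl fun c _ => ?_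
  rw [Real.cosh_eq]
  simp [boolSign]
  ring

theorem sum_exp_rademacher_le {U : Type*} [Fintype U] [DecidableEq U] (a : U → ℝ) :
    ∑ ω : U → Bool, Real.exp (∑ c, a c * boolSign (ω c)) ≤
      2 ^ Fintype.card U * Real.exp ((∑ c, a c ^ 2) / 2) := by
  rw [sum_exp_rademacher, Finset.prod_mul_distrib, Finset.sum_div, Real.exp_sum]
  simp only [Finset.prod_const, Finset.card_univ]
  gcongr with c
  exact Real.cosh_le_exp_half_sq _

theorem card_rademacher_ge {U : Type*} [Fintype U] [DecidableEq U] (a : U → ℝ) {A τ : ℝ}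
    (hA : 0 < A) (hτ : 0 < τ) (haA : ∑ c, a c ^ 2 ≤ A) :
    ((Finset.univ.filter fun ω : U → Bool => τ ≤ ∑ c, a c * boolSign (ω c)).card : ℝ) ≤
      2 ^ Fintype.card U * Real.exp (-(τ ^ 2 / (2 * A))) := by
  -- The Chernoff parameter: it minimises s²A/2 - sτ.
  set s : ℝ := τ / A with hs
  have hspos : 0 < s := div_pos hτ hA
  have h1 := sum_exp_rademacher_le (fun c => s * a c)
  have h2 : ((Finset.univ.filter fun ω : U → Bool => τ ≤ ∑ c, a c * boolSign (ω c)).card : ℝ)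
      * Real.exp (s * τ) ≤ ∑ ω : U → Bool, Real.exp (∑ c, s * a c * boolSign (ω c)) := by
    rw [← nsmul_eq_mul, ← Finset.sum_const]
    refine le_trans (Finset.sum_le_sum fun ω hω => ?_)
      (Finset.sum_le_sum_of_subset_of_nonneg (Finset.subset_univ _)
        fun i _ _ => (Real.exp_pos _).le)
    simp only [Finset.mem_filter, Finset.mem_univ, true_and] at hω
    simp only [mul_assoc, ← Finset.mul_sum]
    gcongr
  have h3 : (∑ c, (s * a c) ^ 2) / 2 ≤ s * τ - τ ^ 2 / (2 * A) := by
    simp only [mul_pow, ← Finset.mul_sum]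
    have : s ^ 2 * ∑ c, a c ^ 2 ≤ s ^ 2 * A := by gcongr
    have e : s ^ 2 * A / 2 = s * τ - τ ^ 2 / (2 * A) := by
      rw [hs]; field_simp; ring
    linarith
  have h4 := h2.trans (h1.trans (mul_le_mul_of_nonneg_left (Real.exp_le_exp.2 h3) (by positivity)))
  rw [sub_eq_add_neg, Real.exp_add, mul_comm (Real.exp (s * τ)), ← mul_assoc] at h4
  exact le_of_mul_le_mul_right h4 (Real.exp_pos _)

/-- Hoeffding's inequality for Rademacher sums, in counting form. -/
theorem card_abs_rademacher_ge {U : Type*} [Fintype U] [DecidableEq U] (a : U → ℝ) {A τ : ℝ}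
    (hA : 0 < A) (hτ : 0 < τ) (haA : ∑ c, a c ^ 2 ≤ A) :
    ((Finset.univ.filter fun ω : U → Bool => τ ≤ |∑ c, a c * boolSign (ω c)|).card : ℝ) ≤
      2 * Real.exp (-(τ ^ 2 / (2 * A))) * 2 ^ Fintype.card U := by
  have h1 := card_rademacher_ge a hA hτ haA
  have h2 := card_rademacher_ge (fun c => -a c) hA hτ (by simpa using haA)
  have h3 : (Finset.univ.filter fun ω : U → Bool => τ ≤ |∑ c, a c * boolSign (ω c)|) ⊆
      (Finset.univ.filter fun ω : U → Bool => τ ≤ ∑ c, a c * boolSign (ω c)) ∪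
      (Finset.univ.filter fun ω : U → Bool => τ ≤ ∑ c, -a c * boolSign (ω c)) := by
    intro ω hω
    simp only [Finset.mem_filter, Finset.mem_univ, true_and, Finset.mem_union, neg_mul,
      Finset.sum_neg_distrib] at hω ⊢
    exact le_abs.1 hω
  have h4 : ((Finset.univ.filter fun ω : U → Bool =>
      τ ≤ |∑ c, a c * boolSign (ω c)|).card : ℝ) ≤ _ :=
    Nat.cast_le.2 ((Finset.card_le_card h3).trans (Finset.card_union_le _ _))
  push_cast at h4
  linarith

/-- First moment method: if every event `Bad v` is rare, then some `ω` avoids, up to a small part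
of the total weight, the events attached to the elements of `M`. -/
theorem exists_small_bad_weight {Ω U E : Type*} [Fintype Ω] [Nonempty Ω] [DecidableEq U]
    (M : Finset E) (wt : E → ℝ) (hwt : ∀ e, 0 ≤ wt e) (N : E → Finset U) (Bad : U → Ω → Prop)
    [∀ v, DecidablePred (Bad v)] {π κ : ℝ}
    (hBad : ∀ v, ((Finset.univ.filter (Bad v)).card : ℝ) ≤ π * Fintype.card Ω)
    (hN : ∀ e ∈ M, ((N e).card : ℝ) * π ≤ κ) :
    ∃ ω, ∑ e ∈ M, (if ∃ v ∈ N e, Bad v ω then wt e else 0) ≤ κ * ∑ e ∈ M, wt e := by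
  suffices h : ∑ ω : Ω, ∑ e ∈ M, (if ∃ v ∈ N e, Bad v ω then wt e else 0) ≤
      ∑ ω : Ω, κ * ∑ e ∈ M, wt e by
    obtain ⟨ω, -, hω⟩ := Finset.exists_le_of_sum_le Finset.univ_nonempty h
    exact ⟨ω, hω⟩
  rw [Finset.sum_comm, Finset.sum_const, nsmul_eq_mul, Finset.mul_sum, Finset.mul_sum]
  refine Finset.sum_le_sum fun e he => ?_
  have h1 : ∀ ω, (if ∃ v ∈ N e, Bad v ω then wt e else 0) ≤
      ∑ v ∈ N e, (if Bad v ω then wt e else 0) := by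
    intro ω
    have hnn : ∀ v ∈ N e, 0 ≤ (if Bad v ω then wt e else 0) := by
      intro v _; split_ifs <;> simp [hwt]
    split_ifs with h
    · obtain ⟨v, hv, hb⟩ := h
      have := Finset.single_le_sum hnn hv
      simpa [hb] using this
    · exact Finset.sum_nonneg hnn
  refine (Finset.sum_le_sum fun ω _ => h1 ω).trans ?_
  rw [Finset.sum_comm]
  have h2 : ∀ v ∈ N e, ∑ ω : Ω, (if Bad v ω then wt e else 0) ≤ π * Fintype.card Ω * wt e := by
    intro v _
    rw [← Finset.sum_filter, Finset.sum_const, nsmul_eq_mul]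
    exact mul_le_mul_of_nonneg_right (hBad v) (hwt e)
  refine (Finset.sum_le_sum h2).trans ?_
  rw [Finset.sum_const, nsmul_eq_mul]
  have := mul_le_mul_of_nonneg_right (hN e he)
    (mul_nonneg (Nat.cast_nonneg (α := ℝ) (Fintype.card Ω)) (hwt e))
  rw [Finset.card_univ]
  linarith

/-! ### Egerváry's theorem: matchings and integral covers -/

/-- The edges of `N` with endpoints given by `p` and `q` are pairwise disjoint. -/
def EndpointDisjoint {U E : Type*} (p q : E → U) (N : Finset E) : Prop :=
  ∀ e ∈ N, ∀ e' ∈ N, (p e = p e' ∨ p e = q e' ∨ q e = q e') → e = e'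

/-- Egerváry's theorem for a square matrix of natural numbers. -/
theorem exists_perm_sum_eq_cover {U : Type*} [Fintype U] [DecidableEq U] (m : U → U → ℕ) :
    ∃ (σ : U → U) (y z : U → ℕ), σ.Injective ∧ (∀ i j, m i j ≤ y i + z j) ∧
      ∑ i, y i + ∑ i, z i = ∑ i, m i (σ i) := by
  classical
  -- Entries of either sign are allowed, so covers can be perturbed freely. A least total still
  -- exists, because it is bounded below by the diagonal of m.
  let Q : ℕ → Prop := fun n => ∃ y z : U → ℤ, (∀ i j, (m i j : ℤ) ≤ y i + z j) ∧
    ∑ i, y i + ∑ i, z i = n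
  have hQ : ∃ n, Q n := by
    refine ⟨∑ i, ∑ j, m i j, fun i => ∑ j, (m i j : ℤ), fun _ => 0, fun i j => ?_, by simp⟩
    simpa using Finset.single_le_sum (f := fun j => (m i j : ℤ)) (fun _ _ => by positivity)
      (Finset.mem_univ j)
  obtain ⟨y, z, hyz, hsum⟩ := Nat.find_spec hQ
  have hmin : ∀ y' z' : U → ℤ, (∀ i j, (m i j : ℤ) ≤ y' i + z' j) →
      ∑ i, y i + ∑ i, z i ≤ ∑ i, y' i + ∑ i, z' i := by
    intro y' z' h
    have h0 : 0 ≤ ∑ i, y' i + ∑ i, z' i := by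
      rw [← Finset.sum_add_distrib]
      exact Finset.sum_nonneg fun i _ => le_trans (by positivity) (h i i)
    have := Nat.find_min' hQ (m := (∑ i, y' i + ∑ i, z' i).toNat) ⟨y', z', h, by
      rw [Int.toNat_of_nonneg h0]⟩
    rw [hsum]
    omega
  let t : U → Finset U := fun i => Finset.univ.filter fun j => (m i j : ℤ) = y i + z j
  -- Hall's condition for the tight pairs: lowering y by 1 on S and raising z by 1 on the tight
  -- neighbours of S leaves a cover, since a pair that is not tight has slack at least 1.
  have hall : ∀ S : Finset U, S.card ≤ (S.biUnion t).card := by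
    intro S
    have h := hmin (fun i => if i ∈ S then y i - 1 else y i)
      (fun j => if j ∈ S.biUnion t then z j + 1 else z j) (by
        intro i j
        have hij := hyz i j
        by_cases hi : i ∈ S <;> by_cases hj : j ∈ S.biUnion t
        · simp only [hi, hj, if_true]; omega
        · simp only [hi, hj, if_true, if_false]
          have : (m i j : ℤ) ≠ y i + z j := fun h =>
            hj (Finset.mem_biUnion.2 ⟨i, hi, by simp [t, h]⟩)
          omega
        · simp only [hi, hj, if_true, if_false]; omega
        · simp only [hi, hj, if_false]; omega)
    have e1 : ∑ i, (if i ∈ S then y i - 1 else y i) = ∑ i, y i - S.card := by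
      have : ∀ i, (if i ∈ S then y i - 1 else y i) = y i - (if i ∈ S then 1 else 0) := by
        intro i; split_ifs <;> simp
      simp [this, Finset.sum_sub_distrib]
    have e2 : ∑ j, (if j ∈ S.biUnion t then z j + 1 else z j) =
        ∑ j, z j + (S.biUnion t).card := by
      have : ∀ i, (if i ∈ S.biUnion t then z i + 1 else z i) =
          z i + (if i ∈ S.biUnion t then 1 else 0) := by
        intro i; split_ifs <;> simp
      rw [Finset.sum_congr rfl fun i _ => this i, Finset.sum_add_distrib, Finset.sum_ite_mem,
        Finset.univ_inter]
      simp
    rw [e1, e2] at h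
    omega
  obtain ⟨σ, hσ, hσt⟩ := (Finset.all_card_le_biUnion_card_iff_exists_injective t).1 hall
  have htight : ∀ i, (m i (σ i) : ℤ) = y i + z (σ i) := fun i => by simpa [t] using hσt i
  have hbij : σ.Bijective := Finite.injective_iff_bijective.1 hσ
  have hzσ : ∑ i, z (σ i) = ∑ i, z i := hbij.sum_comp z
  rcases isEmpty_or_nonempty U with hU | hU
  · exact ⟨σ, fun _ => 0, fun _ => 0, hσ, fun i => hU.elim i, by simp⟩
  -- Shifting by the least y makes both parts nonnegative without changing the total.
  obtain ⟨i₀, -, hi₀⟩ := Finset.exists_min_image Finset.univ y Finset.univ_nonempty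
  have hy0 : ∀ i, 0 ≤ y i - y i₀ := fun i => by have := hi₀ i (Finset.mem_univ i); omega
  have hz0 : ∀ j, 0 ≤ z j + y i₀ := fun j => by have := hyz i₀ j; omega
  refine ⟨σ, fun i => (y i - y i₀).toNat, fun j => (z j + y i₀).toNat, hσ, fun i j => ?_, ?_⟩
  · have := hyz i j
    have := hy0 i
    have := hz0 j
    dsimp only
    omega
  · zify
    simp only [Int.toNat_of_nonneg (hy0 _), Int.toNat_of_nonneg (hz0 _), htight,
      Finset.sum_add_distrib, Finset.sum_sub_distrib, hzσ]
    ring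

/-- Egerváry's theorem for the edges `K` of a bipartite multigraph: some integral cover of `K` has
the weight of a matching in `K`. -/
theorem exists_matching_weight_ge_cover {U E : Type*} [Fintype U] [DecidableEq U]
    (p q : E → U) (w : E → ℕ) (K : Finset E) (side : U → Bool)
    (hside : ∀ e ∈ K, side (p e) ≠ side (q e)) :
    ∃ (N : Finset E) (y : U → ℕ), N ⊆ K ∧ EndpointDisjoint p q N ∧
      (∀ e ∈ K, w e ≤ y (p e) + y (q e)) ∧ ∑ v, y v ≤ ∑ e ∈ N, w e := by
  classical
  rcases isEmpty_or_nonempty E with hE | hE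
  · exact ⟨∅, fun _ => 0, Finset.empty_subset _, fun e => hE.elim e, fun e => hE.elim e, by simp⟩
  let l : E → U := fun e => if side (p e) then p e else q e
  let r : E → U := fun e => if side (p e) then q e else p e
  have hl : ∀ e ∈ K, side (l e) = true := by
    intro e he
    have := hside e he
    cases h1 : side (p e) <;> cases h2 : side (q e) <;> simp_all [l]
  have hr : ∀ e ∈ K, side (r e) = false := by
    intro e he
    have := hside e he
    cases h1 : side (p e) <;> cases h2 : side (q e) <;> simp_all [r]
  let B : U → U → Finset E := fun i j => K.filter fun e => l e = i ∧ r e = j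
  -- Every vertex is both a row and a column. A pair without edges has entry 0, the supremum of the
  -- empty set, so the permutation may use it at no cost.
  obtain ⟨σ, y, z, hσ, hyz, hsum⟩ := exists_perm_sum_eq_cover fun i j => (B i j).sup w
  let I : Finset U := Finset.univ.filter fun i => (B i (σ i)).Nonempty
  have hpick : ∀ i, ∃ e : E, i ∈ I → e ∈ B i (σ i) ∧ (B i (σ i)).sup w = w e := by
    intro i
    by_cases hi : i ∈ I
    · obtain ⟨e, he, h⟩ := Finset.exists_mem_eq_sup (B i (σ i)) (by simpa [I] using hi) w
      exact ⟨e, fun _ => ⟨he, h⟩⟩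
    · exact ⟨hE.some, fun h => absurd h hi⟩
  choose g hg using hpick
  have hgl : ∀ i ∈ I, l (g i) = i := fun i hi => (Finset.mem_filter.1 (hg i hi).1).2.1
  have hgr : ∀ i ∈ I, r (g i) = σ i := fun i hi => (Finset.mem_filter.1 (hg i hi).1).2.2
  have hgK : ∀ i ∈ I, g i ∈ K := fun i hi => (Finset.mem_filter.1 (hg i hi).1).1
  refine ⟨I.image g, fun v => if side v then y v else z v, ?_, ?_, ?_, ?_⟩
  · intro e he
    obtain ⟨i, hi, rfl⟩ := Finset.mem_image.1 he
    exact hgK i hi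
  · intro e he e' he' h
    obtain ⟨i, hi, rfl⟩ := Finset.mem_image.1 he
    obtain ⟨j, hj, rfl⟩ := Finset.mem_image.1 he'
    have key : l (g i) = l (g j) ∨ r (g i) = r (g j) := by
      have h1 := hl _ (hgK i hi)
      have h2 := hl _ (hgK j hj)
      have h3 := hr _ (hgK i hi)
      have h4 := hr _ (hgK j hj)
      simp only [l, r] at h1 h2 h3 h4 ⊢
      rcases h with h | h | h <;> split_ifs at * <;> simp_all
    rcases key with h | h
    · rw [hgl i hi, hgl j hj] at h; rw [h]
    · rw [hgr i hi, hgr j hj] at h; rw [hσ h]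
  · intro e he
    have h1 : w e ≤ y (l e) + z (r e) :=
      le_trans (Finset.le_sup (f := w) (by simp [B, he])) (hyz (l e) (r e))
    have h2 := hl e he
    have h3 := hr e he
    simp only [l, r] at h1 h2 h3 ⊢
    split_ifs at h1 h2 h3 ⊢ <;> simp_all; omega
  · have hinj : Set.InjOn g I := by
      intro i hi j hj h
      rw [← hgl i hi, ← hgl j hj, h]
    rw [Finset.sum_image hinj]
    calc ∑ v, (if side v then y v else z v) ≤ ∑ v, (y v + z v) :=
          Finset.sum_le_sum fun v _ => by split_ifs <;> omega
      _ = ∑ i, (B i (σ i)).sup w := by rw [Finset.sum_add_distrib, hsum]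
      _ = ∑ i ∈ I, (B i (σ i)).sup w := by
          refine (Finset.sum_subset (Finset.subset_univ _) fun i _ hi => ?_).symm
          have : B i (σ i) = ∅ := by
            simpa [I, Finset.not_nonempty_iff_eq_empty] using hi
          simp [this]
      _ = ∑ i ∈ I, w (g i) := Finset.sum_congr rfl fun i hi => (hg i hi).2

/-! ### Balanced colourings -/

theorem exists_fin_injOn {E : Type*} [DecidableEq E] (S : Finset E) {k : ℕ} (hk : 0 < k)
    (hS : S.card ≤ k) : ∃ f : E → Fin k, Set.InjOn f S := by
  refine ⟨fun e => if h : e ∈ S then Fin.castLE hS (S.equivFin ⟨e, h⟩) else ⟨0, hk⟩, ?_⟩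
  intro e he e' he' h
  simp only [Finset.mem_coe] at he he'
  simpa [he, he'] using h

/-- The elements of `S` can be coloured with `k` colours so that elements with the same label get
different colours and the loads of the colours, on top of given loads, differ by at most `W`. -/
theorem exists_balanced_coloring {E L : Type*} [DecidableEq E] [DecidableEq L]
    (S : Finset E) (ℓ : E → L) {k : ℕ} (hk : 0 < k)
    (hℓ : ∀ a, (S.filter fun e => ℓ e = a).card ≤ k) (w : E → ℕ) (W : ℕ) (hw : ∀ e, w e ≤ W)
    (off : Fin k → ℕ) (hoff : ∀ i, off i ≤ W) :
    ∃ col : E → Fin k, (∀ e ∈ S, ∀ e' ∈ S, ℓ e = ℓ e' → col e = col e' → e = e') ∧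
      ∀ i j, off i + ∑ e ∈ S.filter (fun e => col e = i), w e ≤
        off j + ∑ e ∈ S.filter (fun e => col e = j), w e + W := by
  classical
  have hinj : ∀ a, ∃ f : E → Fin k, Set.InjOn f (S.filter fun e => ℓ e = a) := fun a =>
    exists_fin_injOn _ hk (hℓ a)
  choose f hf using hinj
  let Good : (E → Fin k) → Prop := fun col =>
    ∀ e ∈ S, ∀ e' ∈ S, ℓ e = ℓ e' → col e = col e' → e = e'
  let load : (E → Fin k) → Fin k → ℕ := fun col i =>
    off i + ∑ e ∈ S.filter (fun e => col e = i), w e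
  -- An admissible colouring with the least sum of squared loads is balanced.
  have hex : ∃ n, ∃ col, Good col ∧ ∑ i, load col i ^ 2 = n := by
    refine ⟨_, fun e => f (ℓ e) e, fun e he e' he' h1 h2 => ?_, rfl⟩
    have h2 : f (ℓ e) e = f (ℓ e) e' := by simpa [h1] using h2
    exact hf (ℓ e) (by simp [he]) (by simp [he', h1]) h2
  obtain ⟨col, hgood, hcol⟩ := Nat.find_spec hex
  have hmin : ∀ col', Good col' → ∑ i, load col i ^ 2 ≤ ∑ i, load col' i ^ 2 := fun col' h => by
    rw [hcol]; exact Nat.find_min' hex ⟨col', h, rfl⟩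
  refine ⟨col, hgood, fun i j => ?_⟩
  by_contra! hlt
  have hij : i ≠ j := by rintro rfl; omega
  change load col j + W < load col i at hlt
  -- the contribution of the label `a` to the load of the colour `i`
  let part : Fin k → L → ℕ := fun i a => ∑ e ∈ S.filter (fun e => col e = i ∧ ℓ e = a), w e
  have hpart : ∀ i, ∑ e ∈ S.filter (fun e => col e = i), w e = ∑ a ∈ S.image ℓ, part i a := by
    intro i
    rw [← Finset.sum_fiberwise_of_maps_to (s := S.filter fun e => col e = i) (t := S.image ℓ)
      (g := ℓ) (fun e he => Finset.mem_image_of_mem _ (Finset.mem_filter.1 he).1)]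
    simp only [part, Finset.filter_filter]
  -- Otherwise the two loads would differ by at most `off i`, hence by at most W.
  obtain ⟨a, ha⟩ : ∃ a, part j a < part i a := by
    by_contra! h
    have h1 : ∑ a ∈ S.image ℓ, part i a ≤ ∑ a ∈ S.image ℓ, part j a :=
      Finset.sum_le_sum fun a _ => h a
    have h2 := hoff i
    simp only [load, hpart] at hlt
    omega
  have haW : part i a ≤ W := by
    have hcard : (S.filter (fun e => col e = i ∧ ℓ e = a)).card ≤ 1 := by
      rw [Finset.card_le_one]
      intro e he e' he'
      simp only [Finset.mem_filter] at he he'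
      exact hgood e he.1 e' he'.1 (he.2.2.trans he'.2.2.symm) (he.2.1.trans he'.2.1.symm)
    calc part i a ≤ ∑ e ∈ S.filter (fun e => col e = i ∧ ℓ e = a), W :=
          Finset.sum_le_sum fun e _ => hw e
      _ ≤ W := by
          rw [Finset.sum_const, smul_eq_mul]
          exact (Nat.mul_le_mul_right W hcard).trans (by simp)
  -- Exchanging i and j on the label a moves an amount d with 0 < d ≤ W, less than the gap between
  -- the loads, so the sum of squares drops.
  let col' : E → Fin k := fun e => if ℓ e = a then Equiv.swap i j (col e) else col e
  have hgood' : Good col' := by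
    intro e he e' he' h1 h2
    refine hgood e he e' he' h1 ?_
    simp only [col', h1] at h2
    split_ifs at h2 with h
    · exact (Equiv.swap i j).injective h2
    · exact h2
  have hsplit : ∀ c : E → Fin k, ∀ m, ∑ e ∈ S.filter (fun e => c e = m), w e =
      ∑ e ∈ S.filter (fun e => c e = m ∧ ℓ e = a), w e +
      ∑ e ∈ S.filter (fun e => c e = m ∧ ¬ ℓ e = a), w e := by
    intro c m
    rw [← Finset.sum_filter_add_sum_filter_not (S.filter fun e => c e = m) (fun e => ℓ e = a),
      Finset.filter_filter, Finset.filter_filter]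
  have hload : ∀ m, load col' m + part m a = load col m + part (Equiv.swap i j m) a := by
    intro m
    simp only [load, hsplit col', hsplit col]
    have e1 : S.filter (fun e => col' e = m ∧ ℓ e = a) =
        S.filter (fun e => col e = Equiv.swap i j m ∧ ℓ e = a) := by
      refine Finset.filter_congr fun e _ => and_congr_left fun h => ?_
      simp only [col', h, if_true]
      rw [Equiv.swap_apply_eq_iff]
    have e2 : S.filter (fun e => col' e = m ∧ ¬ ℓ e = a) =
        S.filter (fun e => col e = m ∧ ¬ ℓ e = a) := by
      refine Finset.filter_congr fun e _ => and_congr_left fun h => ?_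
      simp only [col', h, if_false]
    rw [e1, e2]
    simp only [part]
    ring
  have hi := hload i
  have hj := hload j
  rw [Equiv.swap_apply_left] at hi
  rw [Equiv.swap_apply_right] at hj
  have hrest : ∀ m, m ≠ i → m ≠ j → load col' m = load col m := by
    intro m h1 h2
    have := hload m
    rw [Equiv.swap_apply_of_ne_of_ne h1 h2] at this
    omega
  have hsq : load col' i ^ 2 + load col' j ^ 2 < load col i ^ 2 + load col j ^ 2 := by
    obtain ⟨d, hd⟩ : ∃ d, part i a = part j a + d := ⟨part i a - part j a, by omega⟩
    have h1 : load col i = load col' i + d := by omega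
    have h2 : load col' j = load col j + d := by omega
    have h3 : 0 < d := by omega
    have h4 : load col j < load col' i := by omega
    rw [h1, h2]
    nlinarith
  have hsum : ∀ g : Fin k → ℕ, ∑ m, g m = g i + g j + ∑ m ∈ (Finset.univ.erase i).erase j, g m := by
    intro g
    rw [← Finset.add_sum_erase Finset.univ g (Finset.mem_univ i),
      ← Finset.add_sum_erase (Finset.univ.erase i) g (by simp [hij.symm] : j ∈ _), add_assoc]
  have hle := hmin col' hgood'
  rw [hsum, hsum (fun m => load col' m ^ 2)] at hle
  have hr : ∑ m ∈ (Finset.univ.erase i).erase j, load col' m ^ 2 =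
      ∑ m ∈ (Finset.univ.erase i).erase j, load col m ^ 2 := by
    refine Finset.sum_congr rfl fun m hm => ?_
    simp only [Finset.mem_erase, Finset.mem_univ, and_true] at hm
    rw [hrest m hm.2 hm.1]
  omega

/-! ### Charging excess degrees to a cover -/

/-- The weighted degree of `v` in the multigraph with edges `H` and endpoints `p`, `q`. -/
noncomputable def endpointDeg {U E : Type*} [DecidableEq U] (p q : E → U) (w : E → ℕ)
    (H : Finset E) (v : U) : ℝ :=
  ∑ e ∈ H, (w e : ℝ) * ((if p e = v then 1 else 0) + (if q e = v then 1 else 0))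

section Charging

variable {U E : Type*} [DecidableEq U] (p q : E → U) (w : E → ℕ)

theorem endpointDeg_nonneg (H : Finset E) (v : U) : 0 ≤ endpointDeg p q w H v :=
  Finset.sum_nonneg fun e _ => by positivity

theorem endpointDeg_mono {H H' : Finset E} (h : H ⊆ H') (v : U) :
    endpointDeg p q w H v ≤ endpointDeg p q w H' v :=
  Finset.sum_le_sum_of_subset_of_nonneg h fun e _ _ => by positivity

theorem sum_endpointDeg_mul [Fintype U] (H : Finset E) (h : U → ℝ) :
    ∑ v, endpointDeg p q w H v * h v = ∑ e ∈ H, (w e : ℝ) * (h (p e) + h (q e)) := by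
  simp only [endpointDeg, Finset.sum_mul]
  rw [Finset.sum_comm]
  refine Finset.sum_congr rfl fun e _ => ?_
  simp only [mul_assoc, ← Finset.mul_sum, add_mul, Finset.sum_add_distrib, ite_mul, one_mul,
    zero_mul, Finset.sum_ite_eq, Finset.mem_univ, if_true]

theorem sum_pair_le_sum_univ [Fintype U] (M : Finset E) (hpq : ∀ e, p e ≠ q e)
    (hM : EndpointDisjoint p q M) (F : U → ℝ) (hF : ∀ v, 0 ≤ F v) :
    ∑ e ∈ M, (F (p e) + F (q e)) ≤ ∑ v, F v := by
  classical
  have h1 : Set.InjOn p M := fun e he e' he' h => hM e he e' he' (Or.inl h)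
  have h2 : Set.InjOn q M := fun e he e' he' h => hM e he e' he' (Or.inr (Or.inr h))
  have hd : Disjoint (M.image p) (M.image q) := by
    rw [Finset.disjoint_left]
    intro v hv hv'
    obtain ⟨e, he, rfl⟩ := Finset.mem_image.1 hv
    obtain ⟨e', he', h⟩ := Finset.mem_image.1 hv'
    obtain rfl := hM e he e' he' (Or.inr (Or.inl h.symm))
    exact hpq e h.symm
  rw [Finset.sum_add_distrib, ← Finset.sum_image h1, ← Finset.sum_image h2,
    ← Finset.sum_union hd]
  exact Finset.sum_le_sum_of_subset_of_nonneg (Finset.subset_univ _) fun v _ _ => hF v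

/-- A cover `y` of a multigraph whose weighted edge-degrees are at most `D` pays for the excess of
the normalized degrees over `y`. -/
theorem sum_excess_le_cover [Fintype U] (H : Finset E) (hw : ∀ e, 1 ≤ w e) {W r D : ℝ}
    (hW : 1 ≤ W) (hr : r = 1 - 1 / (2 * W)) (hD : 0 < D) (y : U → ℝ) (hy0 : ∀ v, 0 ≤ y v)
    (hyW : ∀ v, y v ≤ W) (hcov : ∀ e ∈ H, (w e : ℝ) ≤ y (p e) + y (q e))
    (hdeg : ∀ e ∈ H, endpointDeg p q w H (p e) + endpointDeg p q w H (q e) ≤ D * w e) :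
    ∑ v, max (endpointDeg p q w H v / D - y v) 0 *
      (2 * r - 1 + max (endpointDeg p q w H v / D - y v) 0 / W) ≤ r ^ 2 * ∑ v, y v := by
  have hr2 : 0 ≤ 2 * r - 1 := by
    rw [hr]
    have : 1 / (2 * W) ≤ 1 / 2 := one_div_le_one_div_of_le (by norm_num) (by linarith)
    linarith
  set δ : U → ℝ := fun v => endpointDeg p q w H v / D with hδ
  have hδ0 : ∀ v, 0 ≤ δ v := fun v => div_nonneg (endpointDeg_nonneg p q w H v) hD.le
  have hδe : ∀ e ∈ H, δ (p e) + δ (q e) ≤ w e := by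
    intro e he
    simp only [hδ, ← add_div]
    rw [div_le_iff₀ hD, mul_comm]
    exact hdeg e he
  -- The price per unit of degree. Charging it on all of δ rather than on the excess alone turns the
  -- total into a sum over edges.
  let h : U → ℝ := fun v => if y v < δ v then 2 * r - 1 + (δ v - y v) / W else 0
  have hstep : ∀ v, max (δ v - y v) 0 * (2 * r - 1 + max (δ v - y v) 0 / W) ≤ δ v * h v := by
    intro v
    by_cases hv : y v < δ v
    · have : max (δ v - y v) 0 = δ v - y v := max_eq_left (by linarith)
      simp only [this, h, hv, if_true]
      refine mul_le_mul_of_nonneg_right (by linarith [hy0 v]) ?_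
      have : 0 ≤ (δ v - y v) / W := div_nonneg (by linarith) (by linarith)
      linarith
    · have : max (δ v - y v) 0 = 0 := max_eq_right (by linarith)
      simp [this, h, hv]
  refine (Finset.sum_le_sum fun v _ => hstep v).trans ?_
  -- an edge `e` at `z` charges at most `h` of its other end to `z`
  have hedge : ∀ z u (c : ℝ), δ u + δ z ≤ c → c ≤ y u + y z → 0 < y z →
      (δ z ≤ y z → h u ≤ 2 * r - δ z / y z) ∧ (y z < δ z → h u = 0) := by
    intro z u c h1 h2 h3
    constructor
    · intro h4
      have h5 : δ z / y z ≤ 1 := (div_le_one h3).2 h4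
      by_cases hu : y u < δ u
      · simp only [h, hu, if_true]
        -- The excess at u is at most the slack y z - δ z at the other end; `y z ≤ W` makes it
        -- comparable to y z.
        have h6 : (δ u - y u) / W ≤ (δ u - y u) / y z :=
          div_le_div_of_nonneg_left (by linarith) h3 (hyW z)
        have h7 : (δ u - y u) / y z + δ z / y z ≤ 1 := by
          rw [← add_div, div_le_one h3]; linarith
        linarith
      · simp only [h, hu, if_false]; linarith
    · intro h4
      have hu : ¬ y u < δ u := by linarith
      simp [h, hu]
  have hz : ∀ z, ∑ e ∈ H, (w e : ℝ) * ((if p e = z then h (q e) else 0) +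
      (if q e = z then h (p e) else 0)) ≤ D * (r ^ 2 * y z) := by
    intro z
    have hbound : ∀ k : ℝ, (∀ e ∈ H, p e = z → h (q e) ≤ k) → (∀ e ∈ H, q e = z → h (p e) ≤ k) →
        ∑ e ∈ H, (w e : ℝ) * ((if p e = z then h (q e) else 0) +
          (if q e = z then h (p e) else 0)) ≤ endpointDeg p q w H z * k := by
      intro k h1 h2
      rw [endpointDeg, Finset.sum_mul]
      refine Finset.sum_le_sum fun e he => ?_
      rw [mul_assoc]
      refine mul_le_mul_of_nonneg_left ?_ (by positivity)
      rw [add_mul]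
      refine add_le_add ?_ ?_
      · split_ifs with h3
        · simpa using h1 e he h3
        · simp
      · split_ifs with h3
        · simpa using h2 e he h3
        · simp
    have hdz : endpointDeg p q w H z = D * δ z := by simp only [hδ]; field_simp
    rcases lt_or_ge (y z) (δ z) with hyz | hyz
    · have hb := hbound 0 ?_ ?_
      · have : 0 ≤ D * (r ^ 2 * y z) := mul_nonneg hD.le (mul_nonneg (sq_nonneg _) (hy0 z))
        linarith
      all_goals
        intro e he h1
        have h2 := hδe e he
        have h3 := hcov e he
        rw [h1] at h2 h3
        simp only [h]
        rw [if_neg (by linarith)]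
    · rcases (hy0 z).eq_or_lt with h0 | h0
      -- With y z = 0 also δ z = 0; as weights are positive, no edge of H meets z.
      · have hd0 : endpointDeg p q w H z = 0 := by
          rw [hdz, le_antisymm (hyz.trans h0.symm.le) (hδ0 z), mul_zero]
        have hnone : ∀ e ∈ H, p e ≠ z ∧ q e ≠ z := by
          intro e he
          have h1 := (Finset.sum_eq_zero_iff_of_nonneg (fun e _ => by positivity)).1 hd0 e he
          have h2 : (w e : ℝ) ≠ 0 := by
            have := hw e
            positivity
          have h3 := (mul_eq_zero.1 h1).resolve_left h2
          constructor <;> intro h4 <;> rw [if_pos h4] at h3 <;> split_ifs at h3 <;> norm_num at h3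
        rw [Finset.sum_eq_zero fun e he => by simp [(hnone e he).1, (hnone e he).2], ← h0]
        simp
      · refine (hbound (2 * r - δ z / y z) ?_ ?_).trans ?_
        · intro e he h1
          exact (hedge z (q e) (w e) (by rw [← h1]; linarith [hδe e he])
            (by rw [← h1]; linarith [hcov e he]) h0).1 hyz
        · intro e he h1
          exact (hedge z (p e) (w e) (by rw [← h1]; linarith [hδe e he])
            (by rw [← h1]; linarith [hcov e he]) h0).1 hyz
        · rw [hdz, mul_assoc]
          refine mul_le_mul_of_nonneg_left ?_ hD.le
          have e1 : r ^ 2 * y z - δ z * (2 * r - δ z / y z) = (r * y z - δ z) ^ 2 / y z := by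
            field_simp; ring
          have : 0 ≤ (r * y z - δ z) ^ 2 / y z := by positivity
          linarith
  have hsum : ∑ v, D * (δ v * h v) ≤ ∑ z, D * (r ^ 2 * y z) := by
    calc ∑ v, D * (δ v * h v) = ∑ v, endpointDeg p q w H v * h v := by
          refine Finset.sum_congr rfl fun v _ => ?_
          simp only [hδ]; field_simp
      _ = ∑ e ∈ H, (w e : ℝ) * (h (p e) + h (q e)) := sum_endpointDeg_mul p q w H h
      _ = ∑ z, ∑ e ∈ H, (w e : ℝ) * ((if p e = z then h (q e) else 0) +
            (if q e = z then h (p e) else 0)) := by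
          rw [Finset.sum_comm]
          refine Finset.sum_congr rfl fun e _ => ?_
          rw [← Finset.mul_sum, Finset.sum_add_distrib]
          simp [add_comm]
      _ ≤ _ := Finset.sum_le_sum fun z _ => hz z
  rw [← Finset.mul_sum, ← Finset.mul_sum] at hsum
  rw [Finset.mul_sum]
  exact le_of_mul_le_mul_left hsum hD

/-- By convexity the worst case is an equal split of s = π + ρ, which gives s(2r - 1 + s/(2W)). At s
= 1 the bracket is 2r - 1 + (1 - r) = r: this equation determines r. The factors in η absorb the
loss when s is slightly below t. -/
theorem pair_excess_ge {W r η t π ρ : ℝ} (hW : 1 ≤ W) (hr : r = 1 - 1 / (2 * W)) (hη : 0 ≤ η)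
    (hηW : η * W ≤ 1) (ht : 1 ≤ t) (hsum : t - η * W ≤ π + ρ) :
    r * (1 - η * W) * (1 - η) * t ≤ π * (2 * r - 1 + π / W) + ρ * (2 * r - 1 + ρ / W) := by
  have hW0 : 0 < W := by linarith
  have hrW : 1 / W = 2 * (1 - r) := by rw [hr]; field_simp; ring
  have hi : 1 / W ≤ 1 := (div_le_one hW0).2 hW
  have hi0 : 0 < 1 / W := by positivity
  set θ := 1 - η * W with hθ
  have hθ0 : 0 ≤ θ := by linarith
  set s := π + ρ with hs
  have hst : t * θ ≤ s := by nlinarith [mul_nonneg hη hW0.le]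
  have h1 : s * (2 * r - 1 + s * (1 / W) / 2) ≤
      π * (2 * r - 1 + π / W) + ρ * (2 * r - 1 + ρ / W) := by
    have : π * (2 * r - 1 + π / W) + ρ * (2 * r - 1 + ρ / W) -
        s * (2 * r - 1 + s * (1 / W) / 2) = (1 / W) * (π - ρ) ^ 2 / 2 := by
      rw [hs]; ring
    have : 0 ≤ (1 / W) * (π - ρ) ^ 2 / 2 := by positivity
    linarith
  refine le_trans ?_ h1
  have hθs : θ ≤ s := le_trans (by nlinarith) hst
  have h2 : r * (1 - η) ≤ 2 * r - 1 + s * (1 / W) / 2 := by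
    have h3 : θ * (1 / W) = 1 / W - η := by rw [hθ]; field_simp
    have h4 : θ * (1 / W) ≤ s * (1 / W) := mul_le_mul_of_nonneg_right hθs hi0.le
    nlinarith
  have h5 : 0 ≤ 2 * r - 1 + s * (1 / W) / 2 := by
    have : 0 ≤ s * (1 / W) := mul_nonneg (hθ0.trans hθs) hi0.le
    linarith
  calc r * θ * (1 - η) * t = (t * θ) * (r * (1 - η)) := by ring
    _ ≤ (t * θ) * (2 * r - 1 + s * (1 / W) / 2) :=
        mul_le_mul_of_nonneg_left h2 (mul_nonneg (by linarith) hθ0)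
    _ ≤ _ := mul_le_mul_of_nonneg_right hst h5

/-- If the weighted edge-degrees of `H` are at most `D`, a cover `y` of `H` nearly pays for the
edges of a matching `M` that are covered by `y` or have weighted edge-degree close to `D`. -/
theorem weight_le_of_cover [Fintype U] (H M : Finset E) (hw : ∀ e, 1 ≤ w e) {W : ℕ} (hW : 1 ≤ W)
    (hwW : ∀ e, w e ≤ W) (hpq : ∀ e, p e ≠ q e) {r D η : ℝ} (hr : r = 1 - 1 / (2 * (W : ℝ)))
    (hD : 0 < D) (hη : 0 ≤ η) (hηW : η * W < 1) (y : U → ℕ)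
    (hcov : ∀ e ∈ H, w e ≤ y (p e) + y (q e))
    (hdeg : ∀ e ∈ H, endpointDeg p q w H (p e) + endpointDeg p q w H (q e) ≤ D * w e)
    (hM : EndpointDisjoint p q M)
    (hMdeg : ∀ e ∈ M, y (p e) + y (q e) < w e →
      (1 - η) * D * w e ≤ endpointDeg p q w H (p e) + endpointDeg p q w H (q e)) :
    (1 - η * W) * (1 - η) * ∑ e ∈ M, (w e : ℝ) ≤ (1 + r) * ∑ v, (y v : ℝ) := by
  have hW' : (1 : ℝ) ≤ W := by exact_mod_cast hW
  have hrpos : 0 < r := by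
    rw [hr]
    have : 1 / (2 * (W : ℝ)) ≤ 1 / 2 := one_div_le_one_div_of_le (by norm_num) (by linarith)
    linarith
  -- truncate the cover at `W`
  let y' : U → ℕ := fun v => min (y v) W
  have hcov' : ∀ e, w e ≤ y (p e) + y (q e) ↔ w e ≤ y' (p e) + y' (q e) := by
    intro e
    have := hwW e
    simp only [y']
    omega
  have hsum' : ∑ v, (y' v : ℝ) ≤ ∑ v, (y v : ℝ) :=
    Finset.sum_le_sum fun v _ => by exact_mod_cast min_le_left _ _
  set c : ℝ := (1 - η * W) * (1 - η) with hc
  have hηle : η ≤ η * W := le_mul_of_one_le_right hη hW'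
  have hc0 : 0 ≤ c := mul_nonneg (by linarith) (by linarith)
  have hc1 : c ≤ 1 := by
    have : 0 ≤ η * W := hη.trans hηle
    nlinarith
  set x : U → ℝ := fun v => max (endpointDeg p q w H v / D - y' v) 0 with hx
  have hx0 : ∀ v, 0 ≤ x v := fun v => le_max_right _ _
  have hr2 : 0 ≤ 2 * r - 1 := by
    rw [hr]
    have : 1 / (2 * (W : ℝ)) ≤ 1 / 2 := one_div_le_one_div_of_le (by norm_num) (by linarith)
    linarith
  set F : U → ℝ := fun v => x v * (2 * r - 1 + x v / W) with hF
  have hF0 : ∀ v, 0 ≤ F v := fun v =>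
    mul_nonneg (hx0 v) (add_nonneg hr2 (div_nonneg (hx0 v) (by linarith)))
  have hFy : ∑ v, F v ≤ r ^ 2 * ∑ v, (y' v : ℝ) :=
    sum_excess_le_cover p q w H hw hW' hr hD (fun v => (y' v : ℝ)) (fun v => by positivity)
      (fun v => by exact_mod_cast min_le_right _ _)
      (fun e he => by exact_mod_cast (hcov' e).1 (hcov e he)) hdeg
  have hedge : ∀ e ∈ M, r * (c * w e) ≤
      r * ((y' (p e) : ℝ) + y' (q e)) + (F (p e) + F (q e)) := by
    intro e he
    rcases le_or_gt (w e) (y (p e) + y (q e)) with h | h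
    · have h1 : (w e : ℝ) ≤ y' (p e) + y' (q e) := by exact_mod_cast (hcov' e).1 h
      have h2 : c * w e ≤ (y' (p e) : ℝ) + y' (q e) :=
        (mul_le_of_le_one_left (by positivity) hc1).trans h1
      have := mul_le_mul_of_nonneg_left h2 hrpos.le
      linarith [hF0 (p e), hF0 (q e)]
    · have hlt : y' (p e) + y' (q e) < w e := by
        have := hcov' e
        omega
      set t : ℝ := w e - (y' (p e) + y' (q e)) with ht
      -- Integrality of the cover enters here.
      have ht1 : 1 ≤ t := by
        have : ((y' (p e) + y' (q e) + 1 : ℕ) : ℝ) ≤ w e := by exact_mod_cast hlt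
        push_cast at this
        linarith
      have hd := hMdeg e he h
      have hd' : (1 - η) * w e ≤ endpointDeg p q w H (p e) / D + endpointDeg p q w H (q e) / D := by
        rw [← add_div, le_div_iff₀ hD]
        linarith
      have hηw : η * w e ≤ η * W :=
        mul_le_mul_of_nonneg_left (by exact_mod_cast hwW e) hη
      have hxs : t - η * W ≤ x (p e) + x (q e) := by
        have h1 : endpointDeg p q w H (p e) / D - y' (p e) ≤ x (p e) := le_max_left _ _
        have h2 : endpointDeg p q w H (q e) / D - y' (q e) ≤ x (q e) := le_max_left _ _
        linarith
      have h3 := pair_excess_ge hW' hr hη hηW.le ht1 hxs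
      have h4 : r * (c * ((y' (p e) : ℝ) + y' (q e))) ≤ r * ((y' (p e) : ℝ) + y' (q e)) :=
        mul_le_mul_of_nonneg_left (mul_le_of_le_one_left (by positivity) hc1) hrpos.le
      have h5 : r * (c * w e) = r * (c * ((y' (p e) : ℝ) + y' (q e))) +
          r * (1 - η * W) * (1 - η) * t := by
        rw [hc, ht]; ring
      linarith
  have hs := Finset.sum_le_sum hedge
  rw [← Finset.mul_sum, ← Finset.mul_sum, Finset.sum_add_distrib, ← Finset.mul_sum] at hs
  have hp1 := sum_pair_le_sum_univ p q M hpq hM (fun v => (y' v : ℝ)) fun v => by positivity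
  have hp2 := sum_pair_le_sum_univ p q M hpq hM F hF0
  have hfin : r * (c * ∑ e ∈ M, (w e : ℝ)) ≤ r * ((1 + r) * ∑ v, (y v : ℝ)) := by
    have h1 := mul_le_mul_of_nonneg_left hp1 hrpos.le
    have h2 : (1 + r) * ∑ v, (y' v : ℝ) ≤ (1 + r) * ∑ v, (y v : ℝ) :=
      mul_le_mul_of_nonneg_left hsum' (by linarith)
    have h3 := mul_le_mul_of_nonneg_left h2 hrpos.le
    nlinarith
  exact le_of_mul_le_mul_left hfin hrpos

end Charging

/-! ### Random bipartitions that split a matching -/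

theorem boolSign_beq (a b : Bool) : boolSign (a == b) = boolSign a * boolSign b := by
  cases a <;> cases b <;> simp [boolSign]

/-- The edges of `H` with `v` as an endpoint. -/
def endpointIncident {U E : Type*} [DecidableEq U] (p q : E → U) (H : Finset E) (v : U) :
    Finset E :=
  H.filter fun e => p e = v ∨ q e = v

/-- The edges of `K` whose endpoints lie on different sides. -/
def crossing {U E : Type*} (p q : E → U) (K : Finset E) (side : U → Bool) : Finset E :=
  K.filter fun e => side (p e) ≠ side (q e)

section Bipartition

variable {U E : Type*} [DecidableEq U] (p q : E → U) (w : E → ℕ)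

theorem endpointDeg_eq_sum_incident (hpq : ∀ e, p e ≠ q e) (H : Finset E) (v : U) :
    endpointDeg p q w H v = ∑ e ∈ endpointIncident p q H v, (w e : ℝ) := by
  rw [endpointDeg, endpointIncident, Finset.sum_filter]
  refine Finset.sum_congr rfl fun e _ => ?_
  have := hpq e
  by_cases h1 : p e = v <;> by_cases h2 : q e = v <;> simp_all

theorem card_endpointIncident_le (hpq : ∀ e, p e ≠ q e) (hw : ∀ e, 1 ≤ w e) (H : Finset E)
    (v : U) : ((endpointIncident p q H v).card : ℝ) ≤ endpointDeg p q w H v := by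
  rw [endpointDeg_eq_sum_incident p q w hpq, Finset.card_eq_sum_ones, Nat.cast_sum]
  exact Finset.sum_le_sum fun e _ => by exact_mod_cast hw e

/-- The vertices can be grouped into classes of size at most two so that the endpoints of each edge
of the matching `M` form a class, with opposite marks. -/
theorem exists_matching_classes [Fintype U] (hpq : ∀ e, p e ≠ q e) (M : Finset E)
    (hM : EndpointDisjoint p q M) :
    ∃ (root : U → U) (g : U → Bool),
      (∀ e ∈ M, root (p e) = root (q e) ∧ g (p e) ≠ g (q e)) ∧
      ∀ c, (Finset.univ.filter fun z => root z = c).card ≤ 2 := by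
  classical
  -- The root of q e is p e for e in M; every other vertex is its own root.
  have hex : ∀ v, ∃ u : U, ∃ β : Bool, (β = true ∧ ∃ e ∈ M, q e = v ∧ p e = u) ∨
      (β = false ∧ u = v ∧ ∀ e ∈ M, q e ≠ v) := by
    intro v
    by_cases h : ∃ e ∈ M, q e = v
    · obtain ⟨e, he, h⟩ := h
      exact ⟨p e, true, Or.inl ⟨rfl, e, he, h, rfl⟩⟩
    · push Not at h
      exact ⟨v, false, Or.inr ⟨rfl, rfl, h⟩⟩
  choose root g hg using hex
  refine ⟨root, g, fun e he => ?_, fun c => ?_⟩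
  · have h1 : g (q e) = true ∧ root (q e) = p e := by
      rcases hg (q e) with ⟨h1, e', he', h2, h3⟩ | ⟨-, -, h⟩
      · obtain rfl := hM e he e' he' (Or.inr (Or.inr h2.symm))
        exact ⟨h1, h3.symm⟩
      · exact absurd rfl (h e he)
    have h2 : g (p e) = false ∧ root (p e) = p e := by
      rcases hg (p e) with ⟨-, e', he', h2, -⟩ | ⟨h1, h2, -⟩
      · obtain rfl := hM e he e' he' (Or.inr (Or.inl h2.symm))
        exact absurd h2.symm (hpq e)
      · exact ⟨h1, h2⟩
    simp [h1, h2]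
  · have hsub : (Finset.univ.filter fun z => root z = c) ⊆
        insert c ((M.filter fun e => p e = c).image q) := by
      intro z hz
      simp only [Finset.mem_filter, Finset.mem_univ, true_and] at hz
      simp only [Finset.mem_insert, Finset.mem_image, Finset.mem_filter]
      rcases hg z with ⟨-, e, he, h2, h3⟩ | ⟨-, h, -⟩
      · exact Or.inr ⟨e, ⟨he, h3.trans hz⟩, h2⟩
      · exact Or.inl (h.symm.trans hz)
    have h1 : (M.filter fun e => p e = c).card ≤ 1 := by
      rw [Finset.card_le_one]
      intro e he e' he'
      simp only [Finset.mem_filter] at he he'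
      exact hM e he.1 e' he'.1 (Or.inl (he.2.trans he'.2.symm))
    calc _ ≤ _ := Finset.card_le_card hsub
      _ ≤ ((M.filter fun e => p e = c).image q).card + 1 := Finset.card_insert_le _ _
      _ ≤ 2 := by have := Finset.card_image_le (s := M.filter fun e => p e = c) (f := q); omega

theorem two_mul_crossing_deg (hpq : ∀ e, p e ≠ q e) (H : Finset E) (side : U → Bool) (v : U) :
    2 * endpointDeg p q w (crossing p q H side) v - endpointDeg p q w H v =
      -∑ e ∈ endpointIncident p q H v,
        (w e : ℝ) * (boolSign (side (p e)) * boolSign (side (q e))) := by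
  have h1 : endpointIncident p q (crossing p q H side) v =
      (endpointIncident p q H v).filter fun e => side (p e) ≠ side (q e) := by
    simp only [endpointIncident, crossing, Finset.filter_filter, and_comm]
  rw [endpointDeg_eq_sum_incident p q w hpq, endpointDeg_eq_sum_incident p q w hpq, h1,
    Finset.sum_filter, Finset.mul_sum, ← Finset.sum_sub_distrib, ← Finset.sum_neg_distrib]
  refine Finset.sum_congr rfl fun e _ => ?_
  cases side (p e) <;> cases side (q e) <;> simp [boolSign] <;> ring

/-- For the sides `ω (root v) == g v` given by signs `ω`, the weight of the crossing edges at
`v` deviates from its mean as a Rademacher sum does, up to a bounded error. -/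
theorem exists_rademacher_crossing [Fintype U] [DecidableEq E] (hpq : ∀ e, p e ≠ q e) {W : ℕ}
    (hwW : ∀ e, w e ≤ W) (H M : Finset E) (hM : EndpointDisjoint p q M)
    (hpar : ∀ e ∈ H \ M, ∀ e' ∈ H \ M,
      (p e = p e' ∧ q e = q e' ∨ p e = q e' ∧ q e = p e') → e = e')
    (root : U → U) (g : U → Bool) (hroot : ∀ e ∈ M, root (p e) = root (q e))
    (hfib : ∀ c, (Finset.univ.filter fun z => root z = c).card ≤ 2) (v : U) :
    ∃ a : U → ℝ, ∑ c, a c ^ 2 ≤ 2 * W * endpointDeg p q w H v ∧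
      ∀ ω : U → Bool,
        |2 * endpointDeg p q w (crossing p q H fun u => ω (root u) == g u) v -
          endpointDeg p q w H v| ≤ 2 * W + |∑ c, a c * boolSign (ω c)| := by
  set I := endpointIncident p q H v with hI
  let o : E → U := fun e => if p e = v then q e else p e
  have hIo : ∀ e ∈ I, (p e = v ∧ q e = o e) ∨ (q e = v ∧ p e = o e) := by
    intro e he
    have h1 := (Finset.mem_filter.1 he).2
    by_cases h2 : p e = v
    · exact Or.inl ⟨h2, by simp [o, h2]⟩
    · exact Or.inr ⟨h1.resolve_left h2, by simp [o, h2]⟩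
  have hov : ∀ e ∈ I, o e ≠ v := by
    intro e he h
    have := hpq e
    rcases hIo e he with ⟨h1, h2⟩ | ⟨h1, h2⟩
    · exact this (h1.trans (h2.trans h).symm)
    · exact this ((h2.trans h).trans h1.symm)
  have hinj : Set.InjOn o (I \ M : Finset E) := by
    intro e he e' he' h
    simp only [Finset.mem_coe, Finset.mem_sdiff] at he he'
    have hH : ∀ e ∈ I, e ∈ H := fun e he => (Finset.mem_filter.1 he).1
    refine hpar e (Finset.mem_sdiff.2 ⟨hH e he.1, he.2⟩) e'
      (Finset.mem_sdiff.2 ⟨hH e' he'.1, he'.2⟩) ?_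
    rcases hIo e he.1 with ⟨h1, h2⟩ | ⟨h1, h2⟩ <;> rcases hIo e' he'.1 with ⟨h3, h4⟩ | ⟨h3, h4⟩ <;>
      rw [h1, h2, h3, h4, h] <;> simp
  have hcount : ∀ (S : Finset E) (Z : Finset U), S ⊆ I \ M → (∀ e ∈ S, o e ∈ Z) →
      S.card ≤ Z.card := fun S Z hS hZ =>
    Finset.card_le_card_of_injOn o hZ (hinj.mono (by exact_mod_cast hS))
  have hrootM : ∀ e ∈ I, e ∈ M → root (o e) = root v := by
    intro e he heM
    have := hroot e heM
    rcases hIo e he with ⟨h1, h2⟩ | ⟨h1, h2⟩ <;> rw [h1, h2] at this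
    · exact this.symm
    · exact this
  let R0 := I.filter fun e => root (o e) = root v
  let R1 := I.filter fun e => ¬ root (o e) = root v
  -- Edges inside the class of v are not randomised. There is at most one in M, and at most one
  -- outside M, since the class has at most one vertex besides v.
  have hR0 : R0.card ≤ 2 := by
    have h1 : (R0 \ M).card ≤ 1 := by
      refine (hcount (R0 \ M) ((Finset.univ.filter fun z => root z = root v).erase v)
        (Finset.sdiff_subset_sdiff (Finset.filter_subset _ _) le_rfl) fun e he => ?_).trans ?_
      · have h2 := Finset.mem_filter.1 (Finset.mem_sdiff.1 he).1
        simp [hov e h2.1, h2.2]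
      · rw [Finset.card_erase_of_mem (by simp)]
        have := hfib (root v)
        omega
    have h2 : (R0 ∩ M).card ≤ 1 := by
      rw [Finset.card_le_one]
      intro e he e' he'
      simp only [Finset.mem_inter, R0, Finset.mem_filter] at he he'
      rcases hIo e he.1.1 with ⟨h1, -⟩ | ⟨h1, -⟩ <;> rcases hIo e' he'.1.1 with ⟨h3, -⟩ | ⟨h3, -⟩
      · exact hM e he.2 e' he'.2 (Or.inl (h1.trans h3.symm))
      · exact hM e he.2 e' he'.2 (Or.inr (Or.inl (h1.trans h3.symm)))
      · exact (hM e' he'.2 e he.2 (Or.inr (Or.inl (h3.trans h1.symm)))).symm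
      · exact hM e he.2 e' he'.2 (Or.inr (Or.inr (h1.trans h3.symm)))
    have := Finset.card_inter_add_card_sdiff R0 M
    omega
  have hsumW : ∀ S : Finset E, S.card ≤ 2 → ∑ e ∈ S, (w e : ℝ) ≤ 2 * W := by
    intro S hS
    calc ∑ e ∈ S, (w e : ℝ) ≤ ∑ e ∈ S, (W : ℝ) :=
          Finset.sum_le_sum fun e _ => by exact_mod_cast hwW e
      _ = S.card * (W : ℝ) := by simp
      _ ≤ 2 * W := by
          refine mul_le_mul_of_nonneg_right ?_ (by positivity)
          exact_mod_cast hS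
  let a : U → ℝ := fun c => ∑ e ∈ R1.filter (fun e => root (o e) = c), (w e : ℝ) * boolSign (g (o e))
  have habs : ∀ c, |a c| ≤ ∑ e ∈ R1.filter (fun e => root (o e) = c), (w e : ℝ) := by
    intro c
    refine (Finset.abs_sum_le_sum_abs _ _).trans (le_of_eq (Finset.sum_congr rfl fun e _ => ?_))
    rw [abs_mul, abs_boolSign, mul_one, Nat.abs_cast]
  refine ⟨a, ?_, fun ω => ?_⟩
  -- At most two of these edges lead into a class, so one factor of the square is at most 2W.
  · have h1 : ∀ c, a c ^ 2 ≤ 2 * W * ∑ e ∈ R1.filter (fun e => root (o e) = c), (w e : ℝ) := by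
      intro c
      have h2 : ∑ e ∈ R1.filter (fun e => root (o e) = c), (w e : ℝ) ≤ 2 * W := by
        refine hsumW _ ((hcount _ _ ?_ ?_).trans (hfib c))
        · intro e he
          simp only [R1, Finset.mem_filter] at he
          exact Finset.mem_sdiff.2 ⟨he.1.1, fun h => he.1.2 (hrootM e he.1.1 h)⟩
        · intro e he
          simp [(Finset.mem_filter.1 he).2]
      rw [← sq_abs, sq]
      exact mul_le_mul ((habs c).trans h2) (habs c) (abs_nonneg _) (by positivity)
    refine (Finset.sum_le_sum fun c _ => h1 c).trans ?_
    rw [← Finset.mul_sum, Finset.sum_fiberwise, endpointDeg_eq_sum_incident p q w hpq]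
    refine mul_le_mul_of_nonneg_left ?_ (by positivity)
    exact Finset.sum_le_sum_of_subset_of_nonneg (Finset.filter_subset _ _) fun e _ _ => by positivity
  · have hterm : ∀ e ∈ I, (w e : ℝ) *
        (boolSign (ω (root (p e)) == g (p e)) * boolSign (ω (root (q e)) == g (q e))) =
        boolSign (ω (root v)) * boolSign (g v) *
          (w e * boolSign (g (o e)) * boolSign (ω (root (o e)))) := by
      intro e he
      simp only [boolSign_beq]
      rcases hIo e he with ⟨h1, h2⟩ | ⟨h1, h2⟩ <;> rw [h1, h2] <;> ring
    rw [two_mul_crossing_deg p q w hpq, abs_neg, ← hI, Finset.sum_congr rfl hterm,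
      ← Finset.mul_sum, abs_mul, abs_mul, abs_boolSign, abs_boolSign, one_mul, one_mul,
      ← Finset.sum_filter_add_sum_filter_not I fun e => root (o e) = root v]
    refine (abs_add_le _ _).trans (add_le_add ?_ (le_of_eq ?_))
    · refine (Finset.abs_sum_le_sum_abs _ _).trans (le_trans (le_of_eq ?_) (hsumW R0 hR0))
      refine Finset.sum_congr rfl fun e _ => ?_
      rw [abs_mul, abs_mul, abs_boolSign, abs_boolSign, mul_one, mul_one, Nat.abs_cast]
    · congr 1
      rw [← Finset.sum_fiberwise _ (fun e => root (o e))]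
      refine Finset.sum_congr rfl fun c _ => ?_
      simp only [a, Finset.sum_mul]
      refine Finset.sum_congr rfl fun e he => ?_
      rw [(Finset.mem_filter.1 he).2]

/-- If the weighted edge-degrees of `H` are bounded and those of the edges of the matching `M` outside
`K ⊇ H` are nearly maximal, then `K` has a matching of weight at least about half that of `M`. -/
theorem exists_matching_of_endpointDeg [Fintype U] [DecidableEq E] (hpq : ∀ e, p e ≠ q e)
    {W : ℕ} (hW : 1 ≤ W) (hw : ∀ e, 1 ≤ w e) (hwW : ∀ e, w e ≤ W) {ε lam x : ℝ} (hε0 : 0 < ε)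
    (hε1 : ε < 1 / 2) (hlam : lam = ε / (100 * W)) (hx0 : 0 < x) (hlog : 1 / 2 ≤ Real.log x)
    (hx : 2 * (W : ℝ) ^ 2 * (lam ^ 2)⁻¹ * Real.log x ≤ x) (H K M : Finset E) (hHK : H ⊆ K)
    (hM : EndpointDisjoint p q M)
    (hpar : ∀ e ∈ H \ M, ∀ e' ∈ H \ M,
      (p e = p e' ∧ q e = q e' ∨ p e = q e' ∧ q e = p e') → e = e')
    (hdeg : ∀ e ∈ H, endpointDeg p q w H (p e) + endpointDeg p q w H (q e) ≤ (x - 6 * W) * w e)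
    (hMdeg : ∀ e ∈ M, e ∉ K → ((1 - lam) * x + 4 * W) * w e ≤
      endpointDeg p q w H (p e) + endpointDeg p q w H (q e)) :
    ∃ N ⊆ K, EndpointDisjoint p q N ∧
      ∑ e ∈ M, (w e : ℝ) ≤ (2 - 1 / (2 * (W : ℝ)) + ε) * ∑ e ∈ N, (w e : ℝ) := by
  classical
  have hW' : (1 : ℝ) ≤ W := by exact_mod_cast hW
  have hlampos : 0 < lam := by rw [hlam]; positivity
  have hlamW : lam * W = ε / 100 := by rw [hlam]; field_simp
  have hlamle : lam ≤ ε / 100 := by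
    rw [← hlamW]; exact le_mul_of_one_le_right hlampos.le hW'
  have hlogpos : 0 < Real.log x := by linarith
  -- numerical consequences of the assumption on `x`
  have hx1 : 2 * W ^ 2 * Real.log x ≤ lam ^ 2 * x := by
    have h1 := mul_le_mul_of_nonneg_left hx (sq_nonneg lam)
    have h2 : lam ^ 2 * (2 * (W : ℝ) ^ 2 * (lam ^ 2)⁻¹ * Real.log x) = 2 * W ^ 2 * Real.log x := by
      field_simp
    linarith
  have hxbig : 120 * W ≤ ε * x := by
    have h1 : (W : ℝ) ^ 2 ≤ lam ^ 2 * x := by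
      nlinarith [sq_nonneg (W : ℝ)]
    have h2 : (W : ℝ) ^ 4 * 10000 ≤ ε ^ 2 * x := by
      have h3 := mul_le_mul_of_nonneg_left h1 (sq_nonneg (100 * (W : ℝ)))
      have h4 : (100 * (W : ℝ)) ^ 2 * (lam ^ 2 * x) = ε ^ 2 * x := by
        rw [hlam]; field_simp
      nlinarith
    have h5 : (W : ℝ) ≤ W ^ 4 := le_self_pow₀ hW' (by norm_num)
    have h6 : ε ^ 2 * x ≤ ε * x := by
      have : 0 < ε * x := by positivity
      nlinarith
    nlinarith
  have hxW : (1 : ℝ) ≤ W * x := by nlinarith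
  have hdegW : ∀ v, endpointDeg p q w H v ≤ W * x := by
    intro v
    rcases (endpointIncident p q H v).eq_empty_or_nonempty with h | ⟨e, he⟩
    · rw [endpointDeg_eq_sum_incident p q w hpq, h, Finset.sum_empty]
      positivity
    · have h1 := Finset.mem_filter.1 he
      have h2 := hdeg e h1.1
      have h3 : endpointDeg p q w H v ≤
          endpointDeg p q w H (p e) + endpointDeg p q w H (q e) := by
        have h4 := endpointDeg_nonneg p q w H (p e)
        have h5 := endpointDeg_nonneg p q w H (q e)
        rcases h1.2 with h | h <;> rw [← h] <;> linarith
      have h4 : (w e : ℝ) ≤ W := by exact_mod_cast hwW e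
      have h5 : (x - 6 * W) * w e ≤ x * w e :=
        mul_le_mul_of_nonneg_right (by linarith) (by positivity)
      have h6 : x * w e ≤ x * W := mul_le_mul_of_nonneg_left h4 hx0.le
      linarith
  obtain ⟨root, g, hMroot, hfib⟩ := exists_matching_classes p q hpq M hM
  choose a ha hdev using exists_rademacher_crossing p q w hpq hwW H M hM hpar root g
    (fun e he => (hMroot e he).1) hfib
  -- With variance bound A = 2W²x and τ = 2λx, the Hoeffding exponent is λ²x/W² ≥ 2 log x.
  let Bad : U → (U → Bool) → Prop := fun v ω => 2 * lam * x ≤ |∑ c, a v c * boolSign (ω c)|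
  have hBad : ∀ v, ((Finset.univ.filter (Bad v)).card : ℝ) ≤
      2 / x ^ 2 * Fintype.card (U → Bool) := by
    intro v
    have h1 : ∑ c, a v c ^ 2 ≤ 2 * W ^ 2 * x := by
      refine (ha v).trans ?_
      have := mul_le_mul_of_nonneg_left (hdegW v) (by positivity : (0 : ℝ) ≤ 2 * W)
      linarith
    have h2 := card_abs_rademacher_ge (a v) (A := 2 * W ^ 2 * x) (τ := 2 * lam * x)
      (by positivity) (by positivity) h1
    have h3 : Real.exp (-((2 * lam * x) ^ 2 / (2 * (2 * (W : ℝ) ^ 2 * x)))) ≤ 1 / x ^ 2 := by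
      have h4 : (2 * lam * x) ^ 2 / (2 * (2 * (W : ℝ) ^ 2 * x)) = lam ^ 2 * x / W ^ 2 := by
        field_simp
      have h5 : 2 * Real.log x ≤ lam ^ 2 * x / W ^ 2 := by
        rw [le_div_iff₀ (by positivity)]; linarith
      rw [h4]
      calc Real.exp (-(lam ^ 2 * x / W ^ 2)) ≤ Real.exp (-(2 * Real.log x)) :=
            Real.exp_le_exp.2 (by linarith)
        _ = 1 / x ^ 2 := by
            rw [Real.exp_neg, mul_comm, Real.exp_mul, Real.exp_log hx0]
            norm_num
    refine h2.trans ?_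
    have h6 : (Fintype.card (U → Bool) : ℝ) = 2 ^ Fintype.card U := by
      simp
    rw [h6]
    refine mul_le_mul_of_nonneg_right ?_ (by positivity)
    rw [show 2 / x ^ 2 = 2 * (1 / x ^ 2) by ring]
    exact mul_le_mul_of_nonneg_left h3 zero_le_two
  let J : E → Finset E := fun e =>
    endpointIncident p q H (p e) ∪ endpointIncident p q H (q e)
  -- If all these vertices are good, removing the edges with a bad end removes no edge of H at the
  -- ends of e.
  let N : E → Finset U := fun e => {p e, q e} ∪ ((J e).image p ∪ (J e).image q)
  have hNcard : ∀ e, ((N e).card : ℝ) ≤ 6 * (W * x) := by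
    intro e
    have h1 : (N e).card ≤ 2 + ((J e).card + (J e).card) :=
      (Finset.card_union_le _ _).trans (add_le_add Finset.card_le_two
        ((Finset.card_union_le _ _).trans (add_le_add Finset.card_image_le Finset.card_image_le)))
    have h2 : (J e).card ≤ _ := Finset.card_union_le _ _
    have h3 := card_endpointIncident_le p q w hpq hw H (p e)
    have h4 := card_endpointIncident_le p q w hpq hw H (q e)
    have h5 : ((N e).card : ℝ) ≤ 2 + ((J e).card + (J e).card) := by exact_mod_cast h1
    have h6 : ((J e).card : ℝ) ≤ (endpointIncident p q H (p e)).card +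
        (endpointIncident p q H (q e)).card := by exact_mod_cast h2
    linarith [hdegW (p e), hdegW (q e)]
  obtain ⟨ω, hω⟩ := exists_small_bad_weight (π := 2 / x ^ 2) (κ := ε / 10) M (fun e => (w e : ℝ))
    (fun e => by positivity) N Bad hBad (by
      intro e _
      calc ((N e).card : ℝ) * (2 / x ^ 2) ≤ 6 * (W * x) * (2 / x ^ 2) :=
            mul_le_mul_of_nonneg_right (hNcard e) (by positivity)
        _ = 12 * W / x := by field_simp; ring
        _ ≤ ε / 10 := by rw [div_le_iff₀ hx0]; linarith)
  set side : U → Bool := fun u => ω (root u) == g u with hside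
  have hMside : ∀ e ∈ M, side (p e) ≠ side (q e) := by
    intro e he h
    obtain ⟨h1, h2⟩ := hMroot e he
    simp only [hside, h1] at h
    revert h h2
    cases ω (root (q e)) <;> cases g (p e) <;> cases g (q e) <;> simp
  have hdev' : ∀ v, ¬ Bad v ω → |2 * endpointDeg p q w (crossing p q H side) v -
      endpointDeg p q w H v| ≤ 2 * W + 2 * lam * x := by
    intro v hv
    have h1 := hdev v ω
    have h2 := not_le.1 hv
    linarith
  -- Dropping edges with a bad end secures the upper degree bound on all of H'; the lower bound is
  -- needed only on M', where nothing is lost.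
  let H' := (crossing p q H side).filter fun e => ¬ Bad (p e) ω ∧ ¬ Bad (q e) ω
  let M' := M.filter fun e => ¬ ∃ v ∈ N e, Bad v ω
  obtain ⟨N', y, hN'K, hN', hcov, hsum⟩ := exists_matching_weight_ge_cover p q w
    (crossing p q K side) side fun e he => (Finset.mem_filter.1 he).2
  have hlamx : 0 < lam * x := by positivity
  have hfine : ∀ e ∈ M', ∀ v, (v = p e ∨ v = q e) →
      endpointDeg p q w H' v = endpointDeg p q w (crossing p q H side) v := by
    intro e he v hv
    have hgood : ∀ u ∈ N e, ¬ Bad u ω := by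
      have := (Finset.mem_filter.1 he).2
      push Not at this
      exact this
    rw [endpointDeg_eq_sum_incident p q w hpq, endpointDeg_eq_sum_incident p q w hpq]
    refine Finset.sum_congr ?_ fun _ _ => rfl
    ext f
    simp only [endpointIncident, H', Finset.mem_filter]
    refine ⟨fun h => ⟨h.1.1, h.2⟩, fun h => ⟨⟨h.1, ?_⟩, h.2⟩⟩
    have hf : f ∈ J e := by
      have hfH : f ∈ H := (Finset.mem_filter.1 h.1).1
      rcases hv with rfl | rfl
      · exact Finset.mem_union_left _ (Finset.mem_filter.2 ⟨hfH, h.2⟩)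
      · exact Finset.mem_union_right _ (Finset.mem_filter.2 ⟨hfH, h.2⟩)
    exact ⟨hgood _ (Finset.mem_union_right _
        (Finset.mem_union_left _ (Finset.mem_image_of_mem p hf))),
      hgood _ (Finset.mem_union_right _ (Finset.mem_union_right _ (Finset.mem_image_of_mem q hf)))⟩
  -- Halving with error λx + W per end gives sums at most (1 + 4λ)x/2 and at least (1 - 5λ)x/2, per
  -- unit of weight; η = 9λ works as (1 - 9λ)(1 + 4λ) ≤ 1 - 5λ.
  have hmain := weight_le_of_cover p q w H' M' hw hW hwW hpq (r := 1 - 1 / (2 * (W : ℝ)))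
    (D := x * (1 + 4 * lam) / 2) (η := 9 * lam) rfl (by positivity) (by positivity)
    (by nlinarith) y
    (by
      intro e he
      have h1 := Finset.mem_filter.1 (Finset.mem_filter.1 he).1
      exact hcov e (Finset.mem_filter.2 ⟨hHK h1.1, h1.2⟩))
    (by
      intro e he
      have h1 := Finset.mem_filter.1 he
      have h2 := hdeg e (Finset.mem_filter.1 h1.1).1
      have h3 := (abs_le.1 (hdev' _ h1.2.1)).2
      have h4 := (abs_le.1 (hdev' _ h1.2.2)).2
      have h5 := endpointDeg_mono p q w (Finset.filter_subset _ _ : H' ⊆ crossing p q H side) (p e)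
      have h6 := endpointDeg_mono p q w (Finset.filter_subset _ _ : H' ⊆ crossing p q H side) (q e)
      have h7 : (1 : ℝ) ≤ w e := by exact_mod_cast hw e
      have h8 : lam * x ≤ lam * x * w e := le_mul_of_one_le_right hlamx.le h7
      have h9 : (W : ℝ) ≤ W * w e := le_mul_of_one_le_right (by positivity) h7
      linarith)
    (fun e he e' he' => hM e (Finset.mem_filter.1 he).1 e' (Finset.mem_filter.1 he').1)
    (by
      intro e he hlt
      have heM := (Finset.mem_filter.1 he).1
      -- All of M crosses, so an edge of M in K would be covered by y.
      have heK : e ∉ K := fun h =>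
        absurd (hcov e (Finset.mem_filter.2 ⟨h, hMside e heM⟩)) (by omega)
      have h2 := hMdeg e heM heK
      have hgood : ∀ u ∈ N e, ¬ Bad u ω := by
        have := (Finset.mem_filter.1 he).2
        push Not at this
        exact this
      have h3 := (abs_le.1 (hdev' (p e) (hgood _ (by simp [N])))).1
      have h4 := (abs_le.1 (hdev' (q e) (hgood _ (by simp [N])))).1
      rw [hfine e he _ (Or.inl rfl), hfine e he _ (Or.inr rfl)]
      have h7 : (1 : ℝ) ≤ w e := by exact_mod_cast hw e
      have h8 : lam * x ≤ lam * x * w e := le_mul_of_one_le_right hlamx.le h7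
      have h9 : (W : ℝ) ≤ W * w e := le_mul_of_one_le_right (by positivity) h7
      have h10 : (1 - 9 * lam) * (x * (1 + 4 * lam) / 2) * w e ≤
          (x - 5 * (lam * x)) / 2 * w e := by
        refine mul_le_mul_of_nonneg_right ?_ (by positivity)
        nlinarith
      linarith)
  refine ⟨N', hN'K.trans (Finset.filter_subset _ _), hN', ?_⟩
  have hsum' : ∑ v, (y v : ℝ) ≤ ∑ e ∈ N', (w e : ℝ) := by exact_mod_cast hsum
  have hsplit : ∑ e ∈ M, (w e : ℝ) ≤ ∑ e ∈ M', (w e : ℝ) + ε / 10 * ∑ e ∈ M, (w e : ℝ) := by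
    have h1 := Finset.sum_filter_add_sum_filter_not M (fun e => ∃ v ∈ N e, Bad v ω)
      (fun e => (w e : ℝ))
    rw [Finset.sum_filter] at h1
    have h2 : ∑ e ∈ M', (w e : ℝ) = ∑ e ∈ M.filter (fun e => ¬ ∃ v ∈ N e, Bad v ω), (w e : ℝ) := rfl
    rw [h2]
    linarith
  set S := ∑ e ∈ M, (w e : ℝ)
  set S' := ∑ e ∈ M', (w e : ℝ)
  set T := ∑ e ∈ N', (w e : ℝ)
  set r : ℝ := 1 - 1 / (2 * (W : ℝ)) with hr
  have hS0 : 0 ≤ S := Finset.sum_nonneg fun e _ => by positivity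
  have hS'0 : 0 ≤ S' := Finset.sum_nonneg fun e _ => by positivity
  have hT0 : 0 ≤ T := Finset.sum_nonneg fun e _ => by positivity
  have hr0 : 0 ≤ r := by
    rw [hr, sub_nonneg]
    exact (div_le_one (by positivity)).2 (by linarith)
  have hr1 : r ≤ 1 := by rw [hr]; linarith [(by positivity : 0 ≤ 1 / (2 * (W : ℝ)))]
  have e1 : (2 : ℝ) - 1 / (2 * (W : ℝ)) = 1 + r := by rw [hr]; ring
  rw [e1]
  -- Here 18/100 is twice 9/100, from 9λW = 9ε/100 and 9λ ≤ 9ε/100; the discarded part of M adds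
  -- 10/100 below.
  have h1 : (1 - 18 / 100 * ε) * S' ≤ (1 + r) * T := by
    have h2 : (1 - 18 / 100 * ε) * S' ≤ (1 - 9 * lam * W) * (1 - 9 * lam) * S' := by
      refine mul_le_mul_of_nonneg_right ?_ hS'0
      have : 9 * lam * W = 9 / 100 * ε := by linarith
      rw [this]
      nlinarith
    have h3 := mul_le_mul_of_nonneg_left hsum' (by linarith : 0 ≤ 1 + r)
    linarith
  have h2 : (1 - 28 / 100 * ε) * S ≤ (1 + r) * T := by
    have h3 : (1 - 18 / 100 * ε) * ((1 - ε / 10) * S) ≤ (1 - 18 / 100 * ε) * S' :=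
      mul_le_mul_of_nonneg_left (by linarith) (by linarith)
    have h4 : 0 ≤ ε ^ 2 * S := by positivity
    nlinarith
  have h3 : (1 + r) ≤ (1 + r + ε) * (1 - 28 / 100 * ε) := by nlinarith
  have h4 : (1 - 28 / 100 * ε) * S ≤ (1 - 28 / 100 * ε) * ((1 + r + ε) * T) := by
    have := mul_le_mul_of_nonneg_right h3 hT0
    linarith
  exact le_of_mul_le_mul_left h4 (by linarith)

end Bipartition

/-! ### Splitting vertices according to their capacities -/

namespace WeightedMultigraph

variable {V E : Type*} {W : ℕ} [DecidableEq V]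

/-- The edges at a vertex `v` can be distributed among `b v` copies of `v` so that every copy gets
at most one edge of the `b`-matching `M`, at most one of several parallel edges of `H \ M`, and
nearly the same weight of edges of `H` as any other copy. -/
theorem exists_balanced_split [Fintype E] [DecidableEq E] (G : WeightedMultigraph V E W)
    (b : V → ℕ) (hb : ∀ v, 0 < b v) (hmult : G.MultiplicityBounded b) (H M : Finset E)
    (hM : G.IsBMatching b M) (v : V) :
    ∃ col : E → Fin (b v),
      (∀ e ∈ M, ∀ e' ∈ M, v ∈ G.ends e → v ∈ G.ends e' → col e = col e' → e = e') ∧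
      (∀ e ∈ H \ M, ∀ e' ∈ H \ M, v ∈ G.ends e → G.ends e = G.ends e' → col e = col e' → e = e') ∧
      ∀ i, |((∑ e ∈ (G.incident H v).filter (fun e => col e = i), G.weight e : ℕ) : ℝ) -
        G.wdeg H v / b v| ≤ W := by
  obtain ⟨f, hf⟩ := exists_fin_injOn (G.incident M v) (hb v) (hM v)
  -- Edges of M are placed first, at most one per copy, so they preload a copy by at most W; the
  -- edges of H \ M are then balanced on top, with parallel edges sharing a label.
  let off : Fin (b v) → ℕ := fun i =>
    ∑ e ∈ (G.incident (H ∩ M) v).filter (fun e => f e = i), G.weight e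
  have hfM : ∀ e ∈ M, ∀ e' ∈ M, v ∈ G.ends e → v ∈ G.ends e' → f e = f e' → e = e' :=
    fun e he e' he' hv hv' h => hf (by simp [incident, he, hv]) (by simp [incident, he', hv']) h
  have hoff : ∀ i, off i ≤ W := by
    intro i
    have hcard : ((G.incident (H ∩ M) v).filter (fun e => f e = i)).card ≤ 1 := by
      rw [Finset.card_le_one]
      intro e he e' he'
      simp only [incident, Finset.mem_filter, Finset.mem_inter] at he he'
      exact hfM e he.1.1.2 e' he'.1.1.2 he.1.2 he'.1.2 (he.2.trans he'.2.symm)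
    calc off i ≤ ∑ e ∈ (G.incident (H ∩ M) v).filter (fun e => f e = i), W :=
          Finset.sum_le_sum fun e _ => G.weight_le e
      _ ≤ W := by
          rw [Finset.sum_const, smul_eq_mul]
          exact (Nat.mul_le_mul_right W hcard).trans (by simp)
  have hpar : ∀ s : Sym2 V, ((G.incident (H \ M) v).filter fun e => G.ends e = s).card ≤ b v := by
    intro s
    by_cases hv : v ∈ s
    · obtain ⟨u, rfl⟩ := hv
      refine le_trans (Finset.card_le_card ?_) ((hmult v u).trans (min_le_left _ _))
      intro e he
      simp [(Finset.mem_filter.1 he).2]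
    · rw [Finset.filter_eq_empty_iff.2]
      · simp
      · rintro e he rfl
        exact hv (Finset.mem_filter.1 he).2
  obtain ⟨c, hc, hbal⟩ := exists_balanced_coloring (G.incident (H \ M) v) G.ends (hb v) hpar
    G.weight W G.weight_le off hoff
  let col : E → Fin (b v) := fun e => if e ∈ M then f e else c e
  let load : Fin (b v) → ℕ := fun i =>
    ∑ e ∈ (G.incident H v).filter (fun e => col e = i), G.weight e
  have hload : ∀ i, load i =
      off i + ∑ e ∈ (G.incident (H \ M) v).filter (fun e => c e = i), G.weight e := by
    intro i
    simp only [load, off]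
    rw [← Finset.sum_filter_add_sum_filter_not _ (fun e => e ∈ M)]
    congr 1
    · refine Finset.sum_congr ?_ fun _ _ => rfl
      ext e
      simp only [incident, Finset.mem_filter, Finset.mem_inter, col]
      by_cases h : e ∈ M <;> simp [h]
    · refine Finset.sum_congr ?_ fun _ _ => rfl
      ext e
      simp only [incident, Finset.mem_filter, Finset.mem_sdiff, col]
      by_cases h : e ∈ M <;> simp [h]
  refine ⟨col, ?_, ?_, ?_⟩
  · intro e he e' he' hv hv' h
    simp only [col, he, he', if_true] at h
    exact hfM e he e' he' hv hv' h
  · intro e he e' he' hv hee h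
    have h1 := Finset.mem_sdiff.1 he
    have h2 := Finset.mem_sdiff.1 he'
    simp only [col, h1.2, h2.2, if_false] at h
    exact hc e (Finset.mem_filter.2 ⟨he, hv⟩) e' (Finset.mem_filter.2 ⟨he', hee ▸ hv⟩) hee h
  · intro i
    have hsum : ∑ j, load j = G.wdeg H v := by
      simp only [load, wdeg, totalWeight]
      exact Finset.sum_fiberwise _ _ _
    have hle : ∀ i j, load i ≤ load j + W := fun i j => by rw [hload, hload]; exact hbal i j
    -- Loads that differ pairwise by at most W are within W of their average.
    have h1 : b v * load i ≤ G.wdeg H v + b v * W := by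
      have := Finset.sum_le_sum fun j (_ : j ∈ Finset.univ) => hle i j
      rw [Finset.sum_add_distrib, hsum] at this
      simpa using this
    have h2 : G.wdeg H v ≤ b v * load i + b v * W := by
      have := Finset.sum_le_sum fun j (_ : j ∈ Finset.univ) => hle j i
      rw [hsum] at this
      simpa [mul_add] using this
    have hbv : (0 : ℝ) < b v := by exact_mod_cast hb v
    have h1' : (b v : ℝ) * load i ≤ G.wdeg H v + b v * W := by exact_mod_cast h1
    have h2' : (G.wdeg H v : ℝ) ≤ b v * load i + b v * W := by exact_mod_cast h2
    change |(load i : ℝ) - G.wdeg H v / b v| ≤ W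
    rw [abs_le]
    constructor
    · have : (G.wdeg H v : ℝ) / b v ≤ load i + W := by
        rw [div_le_iff₀ hbv]; linarith
      linarith
    · have : (load i : ℝ) - W ≤ G.wdeg H v / b v := by
        rw [le_div_iff₀ hbv]; linarith
      linarith

/-- Splitting every vertex `v` into `b v` copies turns `b`-matchings into matchings and normalized
degrees into degrees. -/
theorem exists_vertex_split [Fintype E] [DecidableEq E] (G : WeightedMultigraph V E W)
    (b : V → ℕ) (hb : ∀ v, 0 < b v) (hmult : G.MultiplicityBounded b) (H M : Finset E)
    (hM : G.IsBMatching b M) :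
    ∃ p q : E → (Σ v, Fin (b v)), (∀ e, p e ≠ q e) ∧ EndpointDisjoint p q M ∧
      (∀ e ∈ H \ M, ∀ e' ∈ H \ M,
        (p e = p e' ∧ q e = q e' ∨ p e = q e' ∧ q e = p e') → e = e') ∧
      (∀ e, |endpointDeg p q G.weight H (p e) + endpointDeg p q G.weight H (q e) -
        G.normalizedDeg b H (G.ends e)| ≤ 2 * W) ∧
      ∀ N, EndpointDisjoint p q N → G.IsBMatching b N := by
  have hends : ∀ s : Sym2 V, ∃ x y, s = s(x, y) := fun s => by
    induction s with | _ x y => exact ⟨x, y, rfl⟩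
  choose A B hAB using hends
  choose col hcolM hcolH hload using G.exists_balanced_split b hb hmult H M hM
  let p : E → (Σ v, Fin (b v)) := fun e => ⟨A (G.ends e), col _ e⟩
  let q : E → (Σ v, Fin (b v)) := fun e => ⟨B (G.ends e), col _ e⟩
  have hmem : ∀ e v, v ∈ G.ends e ↔ A (G.ends e) = v ∨ B (G.ends e) = v := by
    intro e v
    conv_lhs => rw [hAB (G.ends e)]
    rw [Sym2.mem_iff]
    exact or_congr eq_comm eq_comm
  have hinc : ∀ e v i, (p e = ⟨v, i⟩ ∨ q e = ⟨v, i⟩) ↔ (v ∈ G.ends e ∧ col v e = i) := by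
    intro e v i
    rw [hmem]
    constructor
    · rintro (h | h)
      · cases h; exact ⟨Or.inl rfl, rfl⟩
      · cases h; exact ⟨Or.inr rfl, rfl⟩
    · rintro ⟨rfl | rfl, rfl⟩
      · exact Or.inl rfl
      · exact Or.inr rfl
  have hcommon : ∀ e e', (p e = p e' ∨ p e = q e' ∨ q e = q e') →
      ∃ v, v ∈ G.ends e ∧ v ∈ G.ends e' ∧ col v e = col v e' := by
    intro e e' h
    have key : ∃ u, (p e = u ∨ q e = u) ∧ (p e' = u ∨ q e' = u) := by
      rcases h with h | h | h
      · exact ⟨p e, Or.inl rfl, Or.inl h.symm⟩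
      · exact ⟨p e, Or.inl rfl, Or.inr h.symm⟩
      · exact ⟨q e, Or.inr rfl, Or.inr h.symm⟩
    obtain ⟨⟨v, i⟩, h1, h2⟩ := key
    rw [hinc] at h1 h2
    exact ⟨v, h1.1, h2.1, h1.2.trans h2.2.symm⟩
  have hpq : ∀ e, p e ≠ q e := by
    intro e h
    have h1 : A (G.ends e) = B (G.ends e) := congrArg Sigma.fst h
    apply G.not_loop e
    rw [hAB (G.ends e), Sym2.mk_isDiag_iff]
    exact h1
  have hdeg : ∀ u : (Σ v, Fin (b v)),
      |endpointDeg p q G.weight H u - G.wdeg H u.1 / b u.1| ≤ W := by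
    rintro ⟨v, i⟩
    rw [endpointDeg_eq_sum_incident p q G.weight hpq]
    have : endpointIncident p q H ⟨v, i⟩ = (G.incident H v).filter fun e => col v e = i := by
      ext e
      simp only [endpointIncident, incident, Finset.mem_filter, hinc, and_assoc]
    rw [this]
    exact_mod_cast hload v i
  refine ⟨p, q, hpq, ?_, ?_, ?_, ?_⟩
  · intro e he e' he' h
    obtain ⟨v, h1, h2, h3⟩ := hcommon e e' h
    exact hcolM v e he e' he' h1 h2 h3
  · intro e he e' he' h
    obtain ⟨v, h1, h2, h3⟩ := hcommon e e' (h.elim (fun h => Or.inl h.1) fun h => Or.inr (Or.inl h.1))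
    refine hcolH v e he e' he' h1 ?_ h3
    rw [hAB (G.ends e), hAB (G.ends e')]
    rcases h with ⟨h4, h5⟩ | ⟨h4, h5⟩
    · have h6 : A (G.ends e) = A (G.ends e') := congrArg Sigma.fst h4
      have h7 : B (G.ends e) = B (G.ends e') := congrArg Sigma.fst h5
      rw [h6, h7]
    · have h6 : A (G.ends e) = B (G.ends e') := congrArg Sigma.fst h4
      have h7 : B (G.ends e) = A (G.ends e') := congrArg Sigma.fst h5
      rw [h6, h7, Sym2.eq_swap]
  · intro e
    have h1 : G.normalizedDeg b H (G.ends e) =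
        G.wdeg H (p e).1 / b (p e).1 + G.wdeg H (q e).1 / b (q e).1 := by
      conv_lhs => rw [hAB (G.ends e)]
      rfl
    have h2 := abs_le.1 (hdeg (p e))
    have h3 := abs_le.1 (hdeg (q e))
    rw [h1, abs_le]
    constructor <;> linarith [h2.1, h2.2, h3.1, h3.2]
  · intro N hN v
    have hinj : Set.InjOn (col v) (G.incident N v) := by
      intro e he e' he' h
      have he := Finset.mem_filter.1 he
      have he' := Finset.mem_filter.1 he'
      have h1 := (hinc e v (col v e)).2 ⟨he.2, rfl⟩
      have h2 := (hinc e' v (col v e)).2 ⟨he'.2, h.symm⟩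
      rcases h1 with h1 | h1 <;> rcases h2 with h2 | h2
      · exact hN e he.1 e' he'.1 (Or.inl (h1.trans h2.symm))
      · exact hN e he.1 e' he'.1 (Or.inr (Or.inl (h1.trans h2.symm)))
      · exact (hN e' he'.1 e he.1 (Or.inr (Or.inl (h2.trans h1.symm)))).symm
      · exact hN e he.1 e' he'.1 (Or.inr (Or.inr (h1.trans h2.symm)))
    have := Finset.card_le_card_of_injOn (t := Finset.univ) (col v) (fun _ _ => by simp) hinj
    simpa using this

end WeightedMultigraph

/-! ### Conclusion -/

/-- This extracts x ≥ 2 from the logarithmic hypothesis, as β may be any integer. For n < 0,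
`Real.log n` is log |n| ≥ 0; for n = 0 and n = 1 the quotient is 0 by convention. -/
theorem Int.two_le_of_div_log_pos {n : ℤ} (h : 0 < (n : ℝ) / Real.log n) : 2 ≤ n := by
  by_contra! hn
  rcases le_or_gt n 0 with h0 | h0
  · have h1 : 0 ≤ Real.log n := by
      rcases h0.eq_or_lt with rfl | h0
      · simp
      · rw [← Real.log_abs]
        refine Real.log_nonneg ?_
        have : (1 : ℤ) ≤ |n| := Int.one_le_abs h0.ne
        exact_mod_cast this
    exact absurd h (not_lt.2 (div_nonpos_of_nonpos_of_nonneg (by exact_mod_cast h0) h1))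
  · obtain rfl : n = 1 := by omega
    simp at h


theorem mainTheorem7 (ε : ℝ) (hε0 : 0 < ε) (hε1 : ε < 1 / 2) (W : ℕ) (hW : 1 ≤ W)
    (lam : ℝ) (hlam : lam = ε / (100 * (W : ℝ))) (β βm : ℤ) (hβ : βm + 2 ≤ β)
    (hlog : ((β : ℝ) + 8 * (W : ℝ)) / Real.log ((β : ℝ) + 8 * (W : ℝ)) ≥
      2 * (W : ℝ) ^ 2 * (lam ^ 2)⁻¹)
    (hβm : (βm : ℝ) - 6 * (W : ℝ) ≥ (1 - lam) * ((β : ℝ) + 8 * (W : ℝ)))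
    {V E : Type*} [Fintype V] [DecidableEq V] [Fintype E] [DecidableEq E]
    (G : WeightedMultigraph V E W) (b : V → ℕ) (hb : ∀ v, 0 < b v)
    (hmult : G.MultiplicityBounded b)
    (H : Finset E) (hH : G.HasBoundedWeightedEdgeDegree b H β)
    (X : Finset E) (hX : ∀ e, G.IsUnderfull b H βm e → e ∈ X)
    (MG MHX : Finset E) (hMG : G.IsMaxWeightBMatching b Finset.univ MG)
    (hMHX : G.IsMaxWeightBMatching b (H ∪ X) MHX) :
    (2 - 1 / (2 * (W : ℝ)) + ε) * (G.totalWeight MHX : ℝ) ≥ (G.totalWeight MG : ℝ) := by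
  have hW' : (1 : ℝ) ≤ W := by exact_mod_cast hW
  have hlampos : 0 < lam := by rw [hlam]; positivity
  set x : ℝ := (β : ℝ) + 8 * W with hxdef
  have hx2 : 2 ≤ x := by
    have hcast : ((β + 8 * W : ℤ) : ℝ) = x := by push_cast; rfl
    have h1 : 2 ≤ β + 8 * (W : ℤ) := Int.two_le_of_div_log_pos (by
      rw [hcast]
      exact lt_of_lt_of_le (by positivity) hlog)
    rw [← hcast]
    exact_mod_cast h1
  have hlogx : 1 / 2 ≤ Real.log x := by
    have := Real.log_le_log (by norm_num) hx2
    linarith [Real.log_two_gt_d9]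
  have hx : 2 * (W : ℝ) ^ 2 * (lam ^ 2)⁻¹ * Real.log x ≤ x :=
    (le_div_iff₀ (by linarith)).1 hlog
  obtain ⟨p, q, hpq, hM, hpar, hdeg, hbm⟩ :=
    G.exists_vertex_split b hb hmult H MG hMG.1.2
  have hw1 : ∀ e, (1 : ℝ) ≤ G.weight e := fun e => by exact_mod_cast G.one_le_weight e
  have hWw : ∀ e, (W : ℝ) ≤ W * G.weight e := fun e =>
    le_mul_of_one_le_right (by positivity) (hw1 e)
  obtain ⟨N, hNK, hN, hle⟩ := exists_matching_of_endpointDeg p q G.weight hpq hW G.one_le_weight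
    G.weight_le hε0 hε1 hlam (by linarith) hlogx hx H (H ∪ X) MG Finset.subset_union_left hM hpar
    (fun e he => by
      have h1 := hH e he
      have h2 := (abs_le.1 (hdeg e)).2
      have h3 := hWw e
      -- Of the 8W in x, 2W pays for the splitting error; the remaining 6W covers the 4W error of
      -- the bipartition.
      have h4 : (x - 6 * W) * G.weight e = β * G.weight e + 2 * (W * G.weight e) := by
        rw [hxdef]; ring
      linarith)
    (fun e _ heK => by
      rw [Finset.mem_union, not_or] at heK
      have h1 : (βm : ℝ) * G.weight e ≤ G.normalizedDeg b H (G.ends e) := by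
        by_contra! h
        exact heK.2 (hX e ⟨heK.1, h⟩)
      have h2 := (abs_le.1 (hdeg e)).1
      have h3 := hWw e
      have h4 : ((1 - lam) * x + 4 * W) * G.weight e ≤ (βm - 2 * W) * G.weight e :=
        mul_le_mul_of_nonneg_right (by linarith) (by positivity)
      linarith)
  have hmax : (∑ e ∈ N, (G.weight e : ℝ)) ≤ G.totalWeight MHX := by
    have := hMHX.2 N hNK (hbm N hN)
    unfold WeightedMultigraph.totalWeight at this ⊢
    exact_mod_cast this
  have hMGsum : (G.totalWeight MG : ℝ) = ∑ e ∈ MG, (G.weight e : ℝ) := by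
    simp [WeightedMultigraph.totalWeight]
  have hcoef : 0 ≤ 2 - 1 / (2 * (W : ℝ)) + ε := by
    have : 1 / (2 * (W : ℝ)) ≤ 1 := (div_le_one (by positivity)).2 (by linarith)
    linarith
  rw [hMGsum]
  exact hle.trans (mul_le_mul_of_nonneg_left hmax hcoef)
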